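/- Let $G$ be a finite simple graph. A pebbling step removes two pebbles from one vertex and places one pebble on an adjacent vertex. The pebbling number $f(G)$ is the least integer $m$ such that, for every distribution of $m$ pebbles onto the vertices of $G$ and every vertex $r$, some (possibly empty) sequence of pebbling steps leads to a distribution with at least one pebble on $r$. The graph $G$ is called Class 0 if $f(G)=|V(G)|$. For $n\ge 2t+1$, the Kneser graph $K(n,t)$ has as vertices the $t$-element subsets of $\{1,\dots,n\}$, two of them being adjacent if and only if they are disjoint. Theorem. For every constant $c>0$ there is an integer $t_0$ such that, for all integers $t>t_0$ and $s\ge c\,(t/\log_2 t)^{1/2}$, with $n=2t+s$, the Kneser graph $K(n,t)$ is Class 0. -/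

import Mathlib

/-- The Kneser graph `K(n, t)`: the vertices are the `t`-element subsets of an `n`-element set,
and two (distinct) vertices are adjacent exactly when they are disjoint. -/
def kneserGraph (n t : ℕ) : SimpleGraph {A : Finset (Fin n) // A.card = t} where
  Adj A B := A ≠ B ∧ Disjoint A.1 B.1
  symm := ⟨fun _ _ h => ⟨h.1.symm, h.2.symm⟩⟩
  loopless := ⟨fun _ h => h.1 rfl⟩

namespace Pebbling

variable {V : Type*} [DecidableEq V]

/-- `Step G D D'`: the pebble distribution `D'` arises from `D` by one pebbling step `[u, v]`, that
is, by removing two pebbles from a vertex `u` and placing one pebble at an adjacent vertex `v`. -/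
def Step (G : SimpleGraph V) (D D' : V → ℕ) : Prop :=
  ∃ u v : V, G.Adj u v ∧ 2 ≤ D u ∧ D' = D - Pi.single u 2 + Pi.single v 1

/-- `D` is `r`-solvable: some finite (possibly empty) sequence of pebbling steps leads to a
distribution with a pebble on `r`. -/
def SolvableAt (G : SimpleGraph V) (D : V → ℕ) (r : V) : Prop :=
  ∃ D' : V → ℕ, Relation.ReflTransGen (Step G) D D' ∧ 1 ≤ D' r

/-- `D` is solvable: it is `r`-solvable for every root `r`. -/
def Solvable (G : SimpleGraph V) (D : V → ℕ) : Prop :=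
  ∀ r : V, SolvableAt G D r

/-- The pebbling number of `G`: the least `m` such that every distribution of `m` pebbles on the
vertices of `G` is solvable. (For a graph with no such `m`, in particular a disconnected one, the
value is `0`.) -/
noncomputable def pebblingNumber [Fintype V] (G : SimpleGraph V) : ℕ :=
  sInf {m : ℕ | ∀ D : V → ℕ, ∑ v, D v = m → Solvable G D}

/-- `G` is Class 0: its pebbling number equals its number of vertices. -/
def IsClassZero [Fintype V] (G : SimpleGraph V) : Prop :=
  pebblingNumber G = Fintype.card V

end Pebbling

/-! Two pebbles at the start of a walk and one at each further vertex bring an additional pebble to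
its end. Occupied vertices are thus free relays, and only the set `Z` of empty vertices obstructs.
When there are `N = |V|` pebbles, the surplus on the set `B` of vertices with at least two pebbles
equals `|Z|` (`sum_excess_eq`), so many obstacles force many sources. Pebbles starting within
distance `j` of `v` can be merged along a tree of occupied vertices with a loss of at most the
factor `2 ^ j` (`exists_reach_of_within`).

Suppose that the root cannot be reached. As any two vertices are joined by a walk of length `ℓ`, no
vertex ever gathers `2 ^ ℓ` pebbles. Send out from the sources all walks of an evenly spread family
(`WalkSystem`). At most `4 ^ ℓ` sources get through to a given vertex at a given step, since
otherwise they would gather too much there. From step `ρ` on a walk is at any given vertex with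
probability at most `1 / A`, where `A` exceeds `2 ^ (6 * ℓ)`, so few walks are first stopped that
late; and as the ends are almost uniform, few walks run through. This bounds the number of sources
(`solvableAt_of_sources`), provided that early stops are rare. Early stops are harmless if the
sources own enough pebbles to pay for the first `ρ` steps (`solvableAt_of_many_const`), and rare if
each obstacle is near few sources (`solvableAt_of_many_two`). An obstacle near many sources can be
given a pile of pebbles; collecting such piles greedily leads to one of the two cases
(`solvableAt_of_card_zero_gt`). If `Z` is small, a single pile, or enough sources whose walks mostly
avoid `Z`, suffices (`solvableAt_of_card_zero_le`).

In the Kneser graph the family consists of the images, under all permutations, of one walk that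
exchanges `q ≤ s` elements in every two steps. Its length is about `2 * t / q`. After `2 * κ` steps
it is uniform on a sphere of size at least `t.choose (κ * q)`, roughly `2 ^ (κ * q * log t / 4)` or
more. This beats `2 ^ (12 * t / q)` once `κ * q ^ 2 * log t` is a large multiple of `t`, which is
the assumed bound on `s`, with `κ` depending on `c` (`isClassZero_of_lt`). -/

namespace Pebbling

open Finset

/-! ### Relaying and gathering pebbles along occupied vertices. -/

section Reach

variable {V : Type*} {G : SimpleGraph V}

/-- `Within G P v j x`: some walk of length at most `j` leads from `x` to `v`, with all its
vertices other than `v` in `P`. -/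
def Within (G : SimpleGraph V) (P : Finset V) (v : V) : ℕ → V → Prop
  | 0, x => x = v
  | j + 1, x => Within G P v j x ∨ (x ∈ P ∧ ∃ y, G.Adj x y ∧ Within G P v j y)

variable {P : Finset V} {v : V}

lemma Within.self (j : ℕ) : Within G P v j v := by
  induction j with
  | zero => rfl
  | succ j ih => exact Or.inl ih

lemma Within.mono {i j : ℕ} (hij : i ≤ j) {x : V} (h : Within G P v i x) :
    Within G P v j x := by
  induction hij with
  | refl => exact h
  | step _ ih => exact Or.inl ih

lemma Within.mono_set {P' : Finset V} (hP : P ⊆ P') {j : ℕ} {x : V} (h : Within G P v j x) :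
    Within G P' v j x := by
  induction j generalizing x with
  | zero => exact h
  | succ j ih =>
    rcases h with h | ⟨hx, y, hxy, hy⟩
    · exact Or.inl (ih h)
    · exact Or.inr ⟨hP hx, y, hxy, ih hy⟩

lemma Within.mem {j : ℕ} {x : V} (h : Within G P v j x) (hx : x ≠ v) : x ∈ P := by
  induction j with
  | zero => exact absurd h hx
  | succ j ih =>
    rcases h with h | ⟨hx, -⟩
    · exact ih h
    · exact hx

lemma Within.trans {i j : ℕ} {x w : V} (h : Within G P w i x) (h' : Within G P v j w) :
    Within G P v (i + j) x := by
  induction i generalizing x with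
  | zero => obtain rfl : x = w := h; simpa using h'
  | succ i ih =>
    rw [show i + 1 + j = (i + j) + 1 by omega]
    rcases h with h | ⟨hx, y, hxy, hy⟩
    · exact Or.inl (ih h)
    · exact Or.inr ⟨hx, y, hxy, ih hy⟩

lemma Within.of_walk (x : ℕ → V) (a j : ℕ) (h : ∀ i, a ≤ i → i < a + j → G.Adj (x i) (x (i + 1)))
    (hP : ∀ i, a ≤ i → i < a + j → x i ∈ P) : Within G P (x (a + j)) j (x a) := by
  induction j generalizing a with
  | zero => rfl
  | succ j ih =>
    refine Or.inr ⟨hP a le_rfl (by omega), x (a + 1), h a le_rfl (by omega), ?_⟩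
    have := ih (a + 1) (fun i h1 h2 => h i (by omega) (by omega))
      (fun i h1 h2 => hP i (by omega) (by omega))
    rwa [show a + 1 + j = a + (j + 1) by omega] at this

lemma Within.of_walk_reverse (x : ℕ → V) (j : ℕ) (h : ∀ i < j, G.Adj (x i) (x (i + 1)))
    (hP : ∀ i, 1 ≤ i → i ≤ j → x i ∈ P) : Within G P (x 0) j (x j) := by
  have := Within.of_walk (G := G) (P := P) (fun i => x (j - i)) 0 j (fun i _ hi => by
      have h1 := h (j - (i + 1)) (by omega)
      rw [show j - (i + 1) + 1 = j - i by omega] at h1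
      exact h1.symm) (fun i _ hi => hP _ (by omega) (by omega))
  simpa using this

variable [DecidableEq V]

/-- `Reach G D D'`: the distribution `D'` arises from `D` by a sequence of pebbling steps. -/
abbrev Reach (G : SimpleGraph V) (D D' : V → ℕ) : Prop :=
  Relation.ReflTransGen (Step G) D D'

lemma Step.add_right {D D' : V → ℕ} (h : Step G D D') (F : V → ℕ) :
    Step G (D + F) (D' + F) := by
  obtain ⟨u, v, huv, h2, rfl⟩ := h
  refine ⟨u, v, huv, by simp; omega, ?_⟩
  funext x
  by_cases hx : x = u
  · subst hx
    simp only [Pi.add_apply, Pi.sub_apply, Pi.single_eq_same]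
    omega
  · simp only [Pi.add_apply, Pi.sub_apply, Pi.single_eq_of_ne hx]
    omega

lemma Reach.add_right {D D' : V → ℕ} (h : Reach G D D') (F : V → ℕ) :
    Reach G (D + F) (D' + F) := by
  induction h with
  | refl => exact .refl
  | tail _ hs ih => exact ih.tail (hs.add_right F)

lemma Reach.add {A A' B B' : V → ℕ} (h : Reach G A A') (h' : Reach G B B') :
    Reach G (A + B) (A' + B') := by
  refine (h.add_right B).trans ?_
  rw [add_comm A' B, add_comm A' B']
  exact h'.add_right A'

lemma Reach.sum {ι : Type*} (s : Finset ι) {A A' : ι → V → ℕ}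
    (h : ∀ i ∈ s, Reach G (A i) (A' i)) : Reach G (∑ i ∈ s, A i) (∑ i ∈ s, A' i) := by
  classical
  induction s using Finset.induction_on with
  | empty => simpa using Relation.ReflTransGen.refl
  | insert a s ha ih =>
    rw [sum_insert ha, sum_insert ha]
    exact (h a (mem_insert_self a s)).add (ih fun i hi => h i (mem_insert_of_mem hi))

lemma Reach.nsmul {A A' : V → ℕ} (h : Reach G A A') (k : ℕ) : Reach G (k • A) (k • A') := by
  simpa using Reach.sum (Finset.range k) (A := fun _ => A) (A' := fun _ => A') fun _ _ => h

lemma Reach.single_edge {u v : V} (h : G.Adj u v) (k : ℕ) :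
    Reach G (Pi.single u (2 * k)) (Pi.single v k) := by
  have h1 : Reach G (Pi.single u 2) (Pi.single v 1) :=
    Relation.ReflTransGen.single ⟨u, v, h, by simp, by simp⟩
  have := h1.nsmul k
  rwa [← Pi.single_smul, ← Pi.single_smul, smul_eq_mul, smul_eq_mul, mul_one, mul_comm] at this

lemma Reach.single_walk (x : ℕ → V) (a : ℕ) (h : ∀ i < a, G.Adj (x i) (x (i + 1))) :
    Reach G (Pi.single (x 0) (2 ^ a)) (Pi.single (x a) 1) := by
  suffices H : ∀ k, Reach G (Pi.single (x 0) (2 ^ a * k)) (Pi.single (x a) k) by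
    simpa using H 1
  induction a with
  | zero => intro k; simpa using Relation.ReflTransGen.refl
  | succ a ih =>
    intro k
    have h1 := ih (fun i hi => h i (by omega)) (2 * k)
    rw [pow_succ, mul_assoc]
    exact h1.trans (Reach.single_edge (h a (by omega)) k)

lemma Reach.single_walk_reverse (x : ℕ → V) (a : ℕ) (h : ∀ i < a, G.Adj (x i) (x (i + 1))) :
    Reach G (Pi.single (x a) (2 ^ a)) (Pi.single (x 0) 1) := by
  have := Reach.single_walk (G := G) (fun i => x (a - i)) a (fun i hi => by
    have h1 := h (a - (i + 1)) (by omega)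
    rw [show a - (i + 1) + 1 = a - i by omega] at h1
    exact h1.symm)
  simpa using this

/-- A pebble distribution that dominates one from which the root can be reached is solvable. -/
lemma SolvableAt.of_reach {D A A' F : V → ℕ} {r : V} (h : Reach G A A') (hD : D = A + F)
    (hs : SolvableAt G (A' + F) r) : SolvableAt G D r := by
  obtain ⟨E, hE, h1⟩ := hs
  exact ⟨E, hD ▸ (h.add_right F).trans hE, h1⟩

lemma SolvableAt.of_reach' {D D' : V → ℕ} {r : V} (h : Reach G D D')
    (hs : SolvableAt G D' r) : SolvableAt G D r := by
  obtain ⟨E, hE, h1⟩ := hs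
  exact ⟨E, h.trans hE, h1⟩

lemma SolvableAt.of_single {D : V → ℕ} {r v : V} {k : ℕ}
    (h : Reach G (Pi.single v k) (Pi.single r 1)) (hk : k ≤ D v) : SolvableAt G D r := by
  have hD : D = Pi.single v k + (D - Pi.single v k) := by
    funext x
    by_cases hx : x = v
    · subst hx; simp; omega
    · simp [hx]
  exact SolvableAt.of_reach h hD ⟨_, .refl, by simp⟩

/-- A walk counted by `Within` uses few vertices. -/
lemma Within.exists_small {j : ℕ} {x : V} (h : Within G P v j x) :
    ∃ P₀ ⊆ P, v ∉ P₀ ∧ P₀.card ≤ j ∧ Within G P₀ v j x := by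
  induction j generalizing x with
  | zero => exact ⟨∅, by simp, by simp, by simp, h⟩
  | succ j ih =>
    rcases h with h | ⟨hx, y, hxy, hy⟩
    · obtain ⟨P₀, h1, h2, h3, h4⟩ := ih h
      exact ⟨P₀, h1, h2, by omega, Or.inl h4⟩
    · by_cases hxv : x = v
      · subst hxv
        exact ⟨∅, by simp, by simp, by simp, Within.self _⟩
      obtain ⟨P₀, h1, h2, h3, h4⟩ := ih hy
      refine ⟨insert x P₀, insert_subset hx h1, ?_, (card_insert_le _ _).trans (by omega), ?_⟩
      · simp only [mem_insert, not_or]; exact ⟨Ne.symm hxv, h2⟩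
      · exact Or.inr ⟨mem_insert_self _ _, y, hxy, h4.mono_set (subset_insert _ _)⟩

/-- Bounds how many vertices lose their pebble in one collection. -/
lemma Within.exists_small_of_finset {j : ℕ} {S : Finset V} (h : ∀ x ∈ S, Within G P v j x) :
    ∃ P₀ ⊆ P, v ∉ P₀ ∧ P₀.card ≤ S.card * j ∧ ∀ x ∈ S, Within G P₀ v j x := by
  choose! f h1 h2 h3 h4 using fun x hx => (h x hx).exists_small
  refine ⟨S.biUnion f, biUnion_subset.2 h1, ?_, ?_, ?_⟩
  · simp only [mem_biUnion, not_exists, not_and]; exact h2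
  · exact card_biUnion_le_card_mul _ _ _ h3
  · exact fun x hx => (h4 x hx).mono_set (subset_biUnion_of_mem f hx)

open Classical in
/-- Collecting pebbles along a breadth-first tree: if every vertex within `j` of `v` other than
`v` has a pebble of its own, then of any further pebbles at these vertices at least the
`2⁻ʲ`-fold arrive at `v`. -/
lemma exists_reach_of_within [Fintype V] (j : ℕ) (m : V → ℕ)
    (hm : ∀ x, m x ≠ 0 → Within G P v j x) :
    ∃ E, Reach G ((fun x => if x ≠ v ∧ Within G P v j x then 1 else 0) + m) E ∧
      ∑ x, m x ≤ 2 ^ j * E v := by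
  induction j generalizing m with
  | zero =>
    refine ⟨_, .refl, ?_⟩
    have : ∀ x, x ≠ v → m x = 0 := fun x hx => by
      by_contra h
      exact hx (hm x h)
    rw [Finset.sum_eq_single v (fun x _ hx => this x hx) (by simp)]
    simp
  | succ j ih =>
    set T : Finset V := univ.filter fun x => Within G P v (j + 1) x ∧ ¬ Within G P v j x with hT
    have hTm : ∀ x, x ∈ T ↔ Within G P v (j + 1) x ∧ ¬ Within G P v j x := by simp [hT]
    have hpar : ∀ x ∈ T, ∃ y, G.Adj x y ∧ Within G P v j y := by
      intro x hx
      obtain ⟨h1, h2⟩ := (hTm x).1 hx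
      rcases h1 with h | ⟨-, h⟩
      · exact absurd h h2
      · exact h
    choose! par hadj hw using hpar
    -- The vertex's own pebble compensates for rounding: `⌊(1 + m) / 2⌋ ≥ m / 2`, so each layer
    -- costs exactly a factor of two.
    set c : V → ℕ := fun x => (1 + m x) / 2 with hc
    set m₀ : V → ℕ := fun x => if Within G P v j x then m x else 0 with hm₀
    set m₁ : V → ℕ := ∑ x ∈ T, Pi.single (par x) (c x) with hm₁
    have hm₁0 : ∀ y, m₁ y ≠ 0 → Within G P v j y := by
      intro y hy
      rw [hm₁, Finset.sum_apply] at hy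
      obtain ⟨x, hx, hxy⟩ := Finset.exists_ne_zero_of_sum_ne_zero hy
      have : y = par x := by
        by_contra hne
        exact hxy (Pi.single_eq_of_ne hne _)
      exact this ▸ hw x hx
    obtain ⟨E, hE, hEs⟩ := ih (m₀ + m₁) (by
      intro x hx
      by_cases h0 : m₁ x = 0
      · by_contra hcon
        simp [hm₀, h0, hcon] at hx
      · exact hm₁0 x h0)
    set rest : V → ℕ := ∑ x ∈ T, Pi.single x ((1 + m x) % 2) with hrest
    have hmove : Reach G (∑ x ∈ T, Pi.single x (1 + m x)) (m₁ + rest) := by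
      rw [hm₁, hrest, ← Finset.sum_add_distrib]
      refine Reach.sum T fun x hx => ?_
      have h1 := (Reach.single_edge (hadj x hx) (c x)).add_right (Pi.single x ((1 + m x) % 2))
      rw [← Pi.single_add] at h1
      rwa [show 2 * c x + (1 + m x) % 2 = 1 + m x by simp only [hc]; omega] at h1
    have hsplit : ((fun x => if x ≠ v ∧ Within G P v (j + 1) x then 1 else 0) + m) =
        (∑ x ∈ T, Pi.single x (1 + m x)) +
          ((fun x => if x ≠ v ∧ Within G P v j x then 1 else 0) + m₀) := by
      funext x
      simp only [Pi.add_apply, Finset.sum_apply, Finset.sum_pi_single, hm₀]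
      by_cases hx : Within G P v j x
      · have h1 : Within G P v (j + 1) x := Or.inl hx
        have h2 : x ∉ T := fun h => ((hTm x).1 h).2 hx
        simp [hx, h1, h2]
      · by_cases hx' : Within G P v (j + 1) x
        · have h2 : x ∈ T := (hTm x).2 ⟨hx', hx⟩
          have h3 : x ≠ v := fun h => hx (h ▸ Within.self j)
          simp [hx, hx', h2, h3]
        · have h2 : x ∉ T := fun h => hx' ((hTm x).1 h).1
          have h3 : m x = 0 := by
            by_contra h
            exact hx' (hm x h)
          simp [hx, hx', h2, h3]
    refine ⟨E + rest, ?_, ?_⟩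
    · rw [hsplit]
      refine (hmove.add_right _).trans ?_
      have := hE.add_right rest
      convert this using 1
      abel
    · have hs1 : ∑ x, m₁ x = ∑ x ∈ T, c x := by
        simp only [hm₁, Finset.sum_apply]
        rw [Finset.sum_comm]
        refine Finset.sum_congr rfl fun x _ => ?_
        simp
      have hs2 : ∑ x, m x = ∑ x, m₀ x + ∑ x ∈ T, m x := by
        rw [← Finset.sum_filter_add_sum_filter_not univ (fun x => Within G P v j x) m]
        congr 1
        · rw [Finset.sum_filter]
        · refine (Finset.sum_subset ?_ ?_).symm
          · intro x hx; simp [((hTm x).1 hx).2]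
          · intro x hx hxT
            by_contra h
            exact hxT ((hTm x).2 ⟨hm x h, (mem_filter.1 hx).2⟩)
      have hs3 : ∑ x ∈ T, m x ≤ 2 * ∑ x ∈ T, c x := by
        rw [Finset.mul_sum]
        exact Finset.sum_le_sum fun x _ => by simp only [hc]; omega
      have hs4 : ∑ x, (m₀ + m₁) x = ∑ x, m₀ x + ∑ x, m₁ x := by
        simp [Finset.sum_add_distrib]
      rw [hs4, hs1] at hEs
      have h5 : 2 ^ (j + 1) * (E + rest) v = 2 * (2 ^ j * E v) + 2 ^ (j + 1) * rest v := by
        simp only [Pi.add_apply]; ring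
      rw [h5]
      omega

open Classical in
/-- Pebbles from the sources `S` gather at `v`: each source `s` first sends one pebble to `f s`
at the price of `2 ^ a` pebbles, and from there it is relayed by vertices of `P`. -/
lemma exists_reach_gather [Fintype V] {D : V → ℕ} {S : Finset V} {f : V → V} {a j : ℕ}
    (hf : ∀ s ∈ S, Reach G (Pi.single s (2 ^ a)) (Pi.single (f s) 1))
    (hfw : ∀ s ∈ S, Within G P v j (f s)) (hv : v ∉ P)
    (hD : ∀ x, (if x ∈ P then 1 else 0) + (if x ∈ S then 2 ^ a else 0) ≤ D x) :
    ∃ D' k, Reach G D D' ∧ S.card ≤ 2 ^ j * k ∧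
      ∀ x, D x + (if x = v then k else 0) ≤
        D' x + (if x ∈ P then 1 else 0) + (if x ∈ S then 2 ^ a else 0) := by
  set I : V → ℕ := fun x => if x ≠ v ∧ Within G P v j x then 1 else 0 with hI
  set A : V → ℕ := ∑ s ∈ S, Pi.single s (2 ^ a) with hA
  set m : V → ℕ := ∑ s ∈ S, Pi.single (f s) 1 with hm
  have hA' : ∀ x, A x = if x ∈ S then 2 ^ a else 0 := by
    intro x; simp only [hA, Finset.sum_apply, Finset.sum_pi_single]
  have hI' : ∀ x, I x ≤ if x ∈ P then 1 else 0 := by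
    intro x
    simp only [hI]
    by_cases h : x ≠ v ∧ Within G P v j x
    · simp [h, h.2.mem h.1]
    · simp [h]
  have hIv : I v = 0 := by simp [hI]
  obtain ⟨E, hE, hEs⟩ := exists_reach_of_within (G := G) (P := P) (v := v) j m (by
    intro x hx
    rw [hm, Finset.sum_apply] at hx
    obtain ⟨s, hs, hsx⟩ := Finset.exists_ne_zero_of_sum_ne_zero hx
    have : x = f s := by
      by_contra hne
      exact hsx (Pi.single_eq_of_ne hne _)
    exact this ▸ hfw s hs)
  have hms : ∑ x, m x = S.card := by
    simp only [hm, Finset.sum_apply]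
    rw [Finset.sum_comm]
    simp
  set F : V → ℕ := D - A - I with hF
  have hDF : D = A + (I + F) := by
    funext x
    have h1 := hD x
    have h2 := hI' x
    rw [← hA' x] at h1
    simp only [hF, Pi.add_apply, Pi.sub_apply]
    omega
  refine ⟨E + F, E v, ?_, hms ▸ hEs, ?_⟩
  · rw [hDF]
    refine ((Reach.sum S hf).add_right (I + F)).trans ?_
    have := hE.add_right F
    rwa [show ∑ s ∈ S, Pi.single (f s) 1 + (I + F) = I + m + F by rw [← hm]; abel]
  · intro x
    have h1 := congrFun hDF x
    have h2 := hI' x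
    have h3 := hA' x
    simp only [Pi.add_apply] at h1 ⊢
    by_cases hx : x = v
    · subst hx
      simp only [hv, if_true, if_false, hIv] at h1 h2 ⊢
      omega
    · simp only [hx, if_false] at h1 h2 ⊢
      omega

end Reach

end Pebbling

namespace Pebbling

open Finset

/-! ### Evenly spread families of walks, and vertices whose walks mostly avoid an obstacle set. -/

section WalkSystem

variable {V : Type*} [DecidableEq V] [Fintype V]

open Classical in
/-- A family of walks of length `ℓ` that is spread out evenly: `m` of its members start at each
vertex, a member with a given start is at step `j` at a given vertex with probability at most
`1 / k₀` if `1 ≤ j`, at most `1 / A` if `ρ ≤ j`, and at most `W / |V|` if `j = ℓ`.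
Moreover, large sets of vertices are connected by walks of length `ℓ` that avoid a given small
set. -/
structure WalkSystem (G : SimpleGraph V) (Ω : Type*) [Fintype Ω] (ℓ ρ k₀ A W m : ℕ) where
  walk : Ω → ℕ → V
  adj : ∀ g, ∀ i < ℓ, G.Adj (walk g i) (walk g (i + 1))
  card_eq : ∀ j ≤ ℓ, ∀ v, (univ.filter fun g => walk g j = v).card = m
  spread_first : ∀ j, 1 ≤ j → j ≤ ℓ → ∀ s z,
    (univ.filter fun g => walk g 0 = s ∧ walk g j = z).card * k₀ ≤ m
  spread : ∀ j, ρ ≤ j → j ≤ ℓ → ∀ s z,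
    (univ.filter fun g => walk g 0 = s ∧ walk g j = z).card * A ≤ m
  spread_last : ∀ s z,
    (univ.filter fun g => walk g 0 = s ∧ walk g ℓ = z).card * Fintype.card V ≤ W * m
  connect : ∀ A₁ A₂ Z : Finset V,
    W * (ℓ + 1) * Z.card * Fintype.card V < A₁.card * A₂.card →
    ∃ x : ℕ → V, x 0 ∈ A₁ ∧ x ℓ ∈ A₂ ∧ (∀ i < ℓ, G.Adj (x i) (x (i + 1))) ∧ ∀ i ≤ ℓ, x i ∉ Z
  m_pos : 0 < m
  one_le_rho : 1 ≤ ρ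
  rho_le : ρ ≤ ℓ
  -- In the first `ρ` steps the spread need only beat quantities governed by `ρ`, up to a polynomial
  -- in `ℓ`; later it must beat a power of `2 ^ ℓ`.
  k₀_ge : 2 ^ 8 * (2 ^ ρ) ^ 6 * (ℓ + 1) ^ 2 ≤ k₀
  A_ge : 2 ^ 14 * (2 ^ ρ) ^ 8 * (2 ^ ℓ) ^ 6 * W ^ 4 ≤ A

namespace WalkSystem

variable {G : SimpleGraph V} {Ω : Type*} [Fintype Ω] {ℓ ρ k₀ A W m : ℕ}
  (F : WalkSystem G Ω ℓ ρ k₀ A W m)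

include F

open Classical in
-- The union bound over step, place and start that is behind all later estimates. The set `src j z`
-- holds the admissible starts of walks that are at `z` at step `j`.
lemma card_hits_le (Γ : Finset Ω) (J : Finset ℕ) (Y : Finset V) (src : ℕ → V → Finset V)
    {c b τ : ℕ} (hc : ∀ j ∈ J, ∀ s z,
      (univ.filter fun g => F.walk g 0 = s ∧ F.walk g j = z).card * c ≤ b)
    (hτ : ∀ j ∈ J, ∀ z ∈ Y, (src j z).card ≤ τ)
    (hΓ : ∀ g ∈ Γ, ∃ j ∈ J, F.walk g j ∈ Y ∧ F.walk g 0 ∈ src j (F.walk g j)) :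
    Γ.card * c ≤ J.card * (Y.card * (τ * b)) := by
  have hsub : Γ ⊆ J.biUnion fun j => Y.biUnion fun z => (src j z).biUnion fun s =>
      univ.filter fun g => F.walk g 0 = s ∧ F.walk g j = z := by
    intro g hg
    obtain ⟨j, hj, hY, hs⟩ := hΓ g hg
    simp only [mem_biUnion, mem_filter, mem_univ, true_and]
    exact ⟨j, hj, _, hY, _, hs, rfl, rfl⟩
  calc Γ.card * c
      ≤ (∑ j ∈ J, ∑ z ∈ Y, ∑ s ∈ src j z,
          (univ.filter fun g => F.walk g 0 = s ∧ F.walk g j = z).card) * c := by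
        refine Nat.mul_le_mul_right _ ((card_le_card hsub).trans (card_biUnion_le.trans ?_))
        refine sum_le_sum fun j _ => card_biUnion_le.trans (sum_le_sum fun z _ => card_biUnion_le)
    _ = ∑ j ∈ J, ∑ z ∈ Y, ∑ s ∈ src j z,
          (univ.filter fun g => F.walk g 0 = s ∧ F.walk g j = z).card * c := by
        simp only [sum_mul]
    _ ≤ ∑ j ∈ J, ∑ z ∈ Y, τ * b := by
        refine sum_le_sum fun j hj => sum_le_sum fun z hz => ?_
        refine (sum_le_card_nsmul _ _ b fun s _ => hc j hj s z).trans ?_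
        rw [smul_eq_mul]
        exact Nat.mul_le_mul_right _ (hτ j hj z hz)
    _ = _ := by simp

open Classical in
/-- The vertices from which few walks of the family meet `Y` after their start. -/
def Good (Y : Finset V) (x : V) : Prop :=
  8 * (univ.filter fun g => F.walk g 0 = x ∧ ∃ j, 1 ≤ j ∧ j ≤ ℓ ∧ F.walk g j ∈ Y).card ≤ m

open Classical in
-- Double counting: each vertex of `Y` is met at each step by exactly `m` walks of the whole family,
-- and a vertex that is not good accounts for more than `m / 8` of the hitting walks.
lemma card_not_good_le (Y : Finset V) :
    (univ.filter fun x => ¬ F.Good Y x).card ≤ 8 * ℓ * Y.card := by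
  set H := univ.filter fun g => ∃ j, 1 ≤ j ∧ j ≤ ℓ ∧ F.walk g j ∈ Y with hH
  have h1 : H.card ≤ ℓ * (Y.card * m) := by
    have hsub : H ⊆ (Icc 1 ℓ).biUnion fun j => Y.biUnion fun z =>
        univ.filter fun g => F.walk g j = z := by
      intro g hg
      obtain ⟨-, j, h1, h2, h3⟩ := mem_filter.1 hg
      simp only [mem_biUnion, mem_filter, mem_univ, true_and, mem_Icc]
      exact ⟨j, ⟨h1, h2⟩, _, h3, rfl⟩
    refine (card_le_card hsub).trans ((card_biUnion_le_card_mul _ _ (Y.card * m) ?_).trans_eq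
      (by simp))
    intro j hj
    exact card_biUnion_le_card_mul _ _ _ fun z _ => (F.card_eq j (mem_Icc.1 hj).2 z).le
  have h2 : (univ.filter fun x => ¬ F.Good Y x).card * m ≤ 8 * H.card := by
    rw [← smul_eq_mul]
    refine (card_nsmul_le_sum _ (fun x => 8 * (H.filter fun g => F.walk g 0 = x).card) m ?_).trans ?_
    · intro x hx
      have := (mem_filter.1 hx).2
      simp only [Good, not_le] at this
      refine this.le.trans_eq ?_
      congr 2
      ext g
      simp [hH, and_comm]
    · rw [← mul_sum]
      refine Nat.mul_le_mul_left _ ?_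
      rw [sum_card_fiberwise_eq_card_filter]
      exact card_le_card (filter_subset _ _)
  have h3 : (univ.filter fun x => ¬ F.Good Y x).card * m ≤ 8 * ℓ * Y.card * m := by nlinarith
  exact Nat.le_of_mul_le_mul_right h3 F.m_pos

open Classical in
-- The walks from `v` occupy at least `A` vertices at step `ρ`, too many to be covered by `X` and
-- the vertices that are not good.
lemma exists_good (Y X : Finset V) (v : V) (h : 8 * ℓ * Y.card + X.card < A) :
    ∃ g, F.walk g 0 = v ∧ F.walk g ρ ∉ X ∧ F.Good Y (F.walk g ρ) := by
  by_contra hcon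
  push Not at hcon
  set B := univ.filter fun x => ¬ F.Good Y x
  have h1 := F.card_hits_le (univ.filter fun g => F.walk g 0 = v) {ρ} (X ∪ B) (fun _ _ => {v})
    (c := A) (b := m) (τ := 1) (by
      intro j hj s z
      obtain rfl := mem_singleton.1 hj
      exact F.spread _ le_rfl F.rho_le s z) (by simp) (by
      intro g hg
      have hg0 := (mem_filter.1 hg).2
      refine ⟨ρ, by simp, ?_, by simp [hg0]⟩
      by_cases hX : F.walk g ρ ∈ X
      · exact mem_union_left _ hX
      · exact mem_union_right _ (mem_filter.2 ⟨mem_univ _, hcon g hg0 hX⟩))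
  rw [F.card_eq 0 (Nat.zero_le _)] at h1
  have h2 : (X ∪ B).card ≤ X.card + 8 * ℓ * Y.card :=
    (card_union_le _ _).trans (Nat.add_le_add_left (F.card_not_good_le Y) _)
  have h3 : A * m ≤ (X ∪ B).card * m := by
    simpa [mul_comm, mul_assoc] using h1
  have := Nat.le_of_mul_le_mul_right h3 F.m_pos
  omega

open Classical in
lemma exists_good_finset (Y X : Finset V) (v : V) (n : ℕ)
    (h : 8 * ℓ * Y.card + X.card + n ≤ A) :
    ∃ S : Finset V, S.card = n ∧ ∀ x ∈ S, x ∉ X ∧ F.Good Y x ∧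
      ∃ g, F.walk g 0 = v ∧ F.walk g ρ = x := by
  induction n with
  | zero => exact ⟨∅, by simp, by simp⟩
  | succ n ih =>
    obtain ⟨S, hS, hSx⟩ := ih (by omega)
    obtain ⟨g, hg0, hgX, hg⟩ := F.exists_good Y (X ∪ S) v (by
      have := card_union_le X S
      omega)
    rw [mem_union, not_or] at hgX
    refine ⟨insert (F.walk g ρ) S, by rw [card_insert_of_notMem hgX.2, hS], ?_⟩
    intro x hx
    rcases mem_insert.1 hx with rfl | hx
    · exact ⟨hgX.1, hg, g, hg0, rfl⟩
    · exact hSx x hx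

lemma W_pos [Nonempty V] : 0 < W := by
  classical
  obtain ⟨v⟩ := ‹Nonempty V›
  have h0 := F.card_eq 0 (Nat.zero_le _) v
  obtain ⟨g, hg⟩ : (univ.filter fun g => F.walk g 0 = v).Nonempty := by
    rw [← card_pos, h0]; exact F.m_pos
  have h1 := F.spread_last v (F.walk g ℓ)
  have h2 : 0 < (univ.filter fun g' => F.walk g' 0 = v ∧ F.walk g' ℓ = F.walk g ℓ).card :=
    card_pos.2 ⟨g, by simpa using (mem_filter.1 hg).2⟩
  have h3 : 0 < Fintype.card V := Fintype.card_pos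
  by_contra hW
  have : W = 0 := by omega
  subst this
  have := Nat.mul_pos h2 h3
  omega

lemma A_le_card [Nonempty V] : A ≤ Fintype.card V := by
  classical
  obtain ⟨v⟩ := ‹Nonempty V›
  have h1 := F.card_hits_le (univ.filter fun g => F.walk g 0 = v) {ℓ} univ (fun _ _ => {v})
    (c := A) (b := m) (τ := 1) (by
      intro j hj s z
      obtain rfl := mem_singleton.1 hj
      exact F.spread _ F.rho_le le_rfl s z) (by simp) (by
      intro g hg
      exact ⟨ℓ, by simp, mem_univ _, by simpa using hg⟩)
  rw [F.card_eq 0 (Nat.zero_le _)] at h1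
  have h3 : A * m ≤ Fintype.card V * m := by
    simpa [mul_comm, mul_assoc] using h1
  exact Nat.le_of_mul_le_mul_right h3 F.m_pos

open Classical in
/-- The ends of the walks from a good vertex that avoid `Y` and a small further set. -/
lemma exists_ends {Y U : Finset V} {x : V} (hx : F.Good Y x) (hU : 8 * ℓ * U.card ≤ k₀) :
    ∃ E : Finset V, Fintype.card V ≤ 2 * W * E.card ∧ ∀ y ∈ E, ∃ g, F.walk g 0 = x ∧
      F.walk g ℓ = y ∧ ∀ j, 1 ≤ j → j ≤ ℓ → F.walk g j ∉ Y ∪ U := by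
  have hk : 0 < k₀ := lt_of_lt_of_le (by positivity) F.k₀_ge
  set Γ := univ.filter fun g => F.walk g 0 = x ∧
    ¬ ∃ j, 1 ≤ j ∧ j ≤ ℓ ∧ F.walk g j ∈ Y ∪ U with hΓ
  set B₁ := univ.filter fun g => F.walk g 0 = x ∧ ∃ j, 1 ≤ j ∧ j ≤ ℓ ∧ F.walk g j ∈ Y with hB₁
  set B₂ := univ.filter fun g => F.walk g 0 = x ∧ ∃ j, 1 ≤ j ∧ j ≤ ℓ ∧ F.walk g j ∈ U with hB₂
  have h1 : 8 * B₁.card ≤ m := hx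
  have h2 : 8 * B₂.card ≤ m := by
    have := F.card_hits_le B₂ (Icc 1 ℓ) U (fun _ _ => {x}) (c := k₀) (b := m) (τ := 1)
      (fun j hj s z => F.spread_first j (mem_Icc.1 hj).1 (mem_Icc.1 hj).2 s z) (by simp) (by
        intro g hg
        obtain ⟨-, hg0, j, hj1, hj2, hj⟩ := mem_filter.1 hg
        exact ⟨j, mem_Icc.2 ⟨hj1, hj2⟩, hj, by simpa using hg0⟩)
    simp only [Nat.card_Icc, add_tsub_cancel_right, one_mul] at this
    have h3 : 8 * B₂.card * k₀ ≤ m * k₀ := by nlinarith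
    exact Nat.le_of_mul_le_mul_right h3 hk
  -- At most `m / 8` walks are lost to each of `Y` and `U`: to `Y` because `x` is good, to `U`
  -- because it is small compared with `k₀`. More than half remain.
  have h3 : m ≤ Γ.card + B₁.card + B₂.card := by
    rw [← F.card_eq 0 (Nat.zero_le _) x]
    have hsub : (univ.filter fun g => F.walk g 0 = x) ⊆ Γ ∪ B₁ ∪ B₂ := by
      intro g hg
      have hg0 := (mem_filter.1 hg).2
      simp only [hΓ, hB₁, hB₂, mem_union, mem_filter, mem_univ, true_and, hg0]
      by_contra hcon
      push Not at hcon
      obtain ⟨⟨⟨j, hj1, hj2, hj⟩, h5⟩, h6⟩ := hcon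
      exact hj.elim (h5 j hj1 hj2) (h6 j hj1 hj2)
    exact (card_le_card hsub).trans ((card_union_le _ _).trans
      (Nat.add_le_add_right (card_union_le _ _) _))
  refine ⟨Γ.image fun g => F.walk g ℓ, ?_, ?_⟩
  · have := F.card_hits_le Γ {ℓ} (Γ.image fun g => F.walk g ℓ) (fun _ _ => {x})
      (c := Fintype.card V) (b := W * m) (τ := 1) (by
        intro j hj s z
        obtain rfl := mem_singleton.1 hj
        exact F.spread_last s z) (by simp) (by
        intro g hg
        exact ⟨ℓ, by simp, mem_image_of_mem _ hg, by simpa using (mem_filter.1 hg).2.1⟩)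
    simp only [card_singleton, one_mul] at this
    have h4 : m ≤ 2 * Γ.card := by omega
    have h5 : Fintype.card V * m ≤ 2 * W * (Γ.image fun g => F.walk g ℓ).card * m := by
      nlinarith
    exact Nat.le_of_mul_le_mul_right h5 F.m_pos
  · intro y hy
    obtain ⟨g, hg, rfl⟩ := mem_image.1 hy
    obtain ⟨-, h5, h6⟩ := mem_filter.1 hg
    exact ⟨g, h5, rfl, fun j hj1 hj2 hj => h6 ⟨j, hj1, hj2, hj⟩⟩

/-- The walks from `x` and from `w` that avoid the obstacles end in large sets, which `connect`
joins. This gives three stretches of length `ℓ`, the last one run backwards. Only the start `x` may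
lie in `Y ∪ U`, apart from the end `w`. -/
lemma within_of_good {Y U : Finset V} {x w : V} (hx : F.Good Y x) (hw : F.Good Y w)
    (hU : 8 * ℓ * U.card ≤ k₀)
    (hN : 4 * W ^ 3 * (ℓ + 1) * (Y.card + U.card) < Fintype.card V) :
    Within G (insert x (Y ∪ U)ᶜ) w (3 * ℓ) x := by
  obtain ⟨E₁, hE₁, h₁⟩ := F.exists_ends hx hU
  obtain ⟨E₂, hE₂, h₂⟩ := F.exists_ends hw hU
  obtain ⟨p, hp0, hpl, hpa, hpZ⟩ := F.connect E₁ E₂ (Y ∪ U) (by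
    have hc := card_union_le Y U
    have h1 : Fintype.card V * Fintype.card V ≤ 4 * W ^ 2 * (E₁.card * E₂.card) := by
      calc _ ≤ (2 * W * E₁.card) * (2 * W * E₂.card) := Nat.mul_le_mul hE₁ hE₂
        _ = _ := by ring
    have hNpos : 0 < Fintype.card V := by omega
    have h2 : 4 * W ^ 2 * (W * (ℓ + 1) * (Y ∪ U).card * Fintype.card V) <
        Fintype.card V * Fintype.card V := by
      calc _ = (4 * W ^ 3 * (ℓ + 1) * (Y ∪ U).card) * Fintype.card V := by ring
        _ ≤ (4 * W ^ 3 * (ℓ + 1) * (Y.card + U.card)) * Fintype.card V := by gcongr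
        _ < _ := Nat.mul_lt_mul_of_pos_right hN hNpos
    exact Nat.lt_of_mul_lt_mul_left (h2.trans_le h1))
  obtain ⟨g, hg0, hgl, hg⟩ := h₁ _ hp0
  obtain ⟨g', hg0', hgl', hg'⟩ := h₂ _ hpl
  have hc1 : Within G (insert x (Y ∪ U)ᶜ) (F.walk g ℓ) ℓ x := by
    have := Within.of_walk (G := G) (P := insert x (Y ∪ U)ᶜ) (F.walk g) 0 ℓ
      (fun i _ hi => F.adj g i (by omega)) (fun i _ hi => by
        rcases Nat.eq_zero_or_pos i with rfl | h0
        · rw [hg0]; exact mem_insert_self _ _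
        · exact mem_insert_of_mem (mem_compl.2 (hg i h0 (by omega))))
    rwa [hg0, zero_add] at this
  have hc2 : Within G (insert x (Y ∪ U)ᶜ) (p ℓ) ℓ (p 0) := by
    have := Within.of_walk (G := G) (P := insert x (Y ∪ U)ᶜ) p 0 ℓ
      (fun i _ hi => hpa i (by omega))
      (fun i _ hi => mem_insert_of_mem (mem_compl.2 (hpZ i (by omega))))
    rwa [zero_add] at this
  have hc3 : Within G (insert x (Y ∪ U)ᶜ) w ℓ (F.walk g' ℓ) := by
    have := Within.of_walk_reverse (G := G) (P := insert x (Y ∪ U)ᶜ) (F.walk g') ℓ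
      (F.adj g') (fun i hi hi' => mem_insert_of_mem (mem_compl.2 (hg' i hi hi')))
    rwa [hg0'] at this
  have hcc : Within G (insert x (Y ∪ U)ᶜ) (F.walk g' ℓ) (ℓ + ℓ) x := by
    rw [hgl']
    rw [hgl] at hc1
    exact hc1.trans hc2
  have hccc := hcc.trans hc3
  rwa [show ℓ + ℓ + ℓ = 3 * ℓ by ring] at hccc

/-- With nothing to avoid, `connect` joins any two vertices by a walk of length `ℓ`. -/
lemma exists_reach_single (u v : V) : Reach G (Pi.single u (2 ^ ℓ)) (Pi.single v 1) := by
  obtain ⟨p, h0, hl, ha, -⟩ := F.connect {u} {v} ∅ (by simp)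
  have := Reach.single_walk p ℓ ha
  rwa [mem_singleton.1 h0, mem_singleton.1 hl] at this

lemma solvableAt_of_le {D : V → ℕ} {v r : V} (h : 2 ^ ℓ ≤ D v) : SolvableAt G D r :=
  SolvableAt.of_single (F.exists_reach_single v r) h

end WalkSystem

end WalkSystem

end Pebbling

namespace Pebbling

open Finset

/-! ### Criteria for solvability. -/

section ClassZero

variable {V : Type*} [DecidableEq V] [Fintype V] {G : SimpleGraph V}

omit [DecidableEq V] [Fintype V] in
lemma exists_first_hit (x : ℕ → V) (Y : Finset V) {a j : ℕ} (haj : a ≤ j) (hj : x j ∈ Y) :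
    ∃ i, a ≤ i ∧ i ≤ j ∧ x i ∈ Y ∧ ∀ t, a ≤ t → t < i → x t ∉ Y := by
  classical
  have hex : ∃ i, a ≤ i ∧ x i ∈ Y := ⟨j, haj, hj⟩
  refine ⟨Nat.find hex, (Nat.find_spec hex).1, Nat.find_min' hex ⟨haj, hj⟩,
    (Nat.find_spec hex).2, fun t ht hti h => Nat.find_min hex hti ⟨ht, h⟩⟩

omit [Fintype V] in
lemma Within.erase {P : Finset V} {v x : V} {j : ℕ} (h : Within G P v j x) :
    Within G (P.erase v) v j x := by
  obtain ⟨P₀, h1, h2, -, h4⟩ := h.exists_small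
  exact h4.mono_set fun y hy => mem_erase.2 ⟨by rintro rfl; exact h2 hy, h1 hy⟩

open Classical in
/-- Sources that reach `v` within few steps pay for several pebbles at `v`, and only few vertices
lose pebbles. -/
lemma exists_reach_collect {D : V → ℕ} {Y S : Finset V} {v : V} {i k : ℕ}
    (hDY : ∀ x ∉ Y, 1 ≤ D x) (hDS : ∀ x ∈ S, 2 ≤ D x) (hv : v ∉ S)
    (hw : ∀ s ∈ S, Within G Yᶜ v i s) (hk : 2 ^ i * k ≤ S.card) :
    ∃ D' P₀, Reach G D D' ∧ Disjoint P₀ Y ∧ v ∉ P₀ ∧ S ⊆ P₀ ∧ P₀.card ≤ S.card * i ∧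
      (∀ x, D x + (if x = v then k else 0) ≤
        D' x + (if x ∈ P₀ then 1 else 0) + (if x ∈ S then 1 else 0)) := by
  obtain ⟨P₀, h1, h2, h3, h4⟩ := Within.exists_small_of_finset hw
  have hSP : S ⊆ P₀ := fun s hs => (h4 s hs).mem fun h => hv (h ▸ hs)
  have hY : ∀ x ∈ P₀, x ∉ Y := fun x hx => mem_compl.1 (h1 hx)
  obtain ⟨D', k', hr, hk', hD'⟩ := exists_reach_gather (G := G) (D := D) (S := S) (f := id)
    (a := 0) (j := i) (P := P₀) (v := v) (fun s _ => by simpa using Relation.ReflTransGen.refl) h4 h2 (by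
      intro x
      by_cases hxS : x ∈ S
      · simp [hSP hxS, hxS, hDS x hxS]
      · by_cases hxP : x ∈ P₀
        · simp [hxS, hxP, hDY x (hY x hxP)]
        · simp [hxS, hxP])
  have hkk : k ≤ k' := Nat.le_of_mul_le_mul_left (hk.trans hk') (by positivity)
  refine ⟨D', P₀, hr, disjoint_left.2 hY, h2, hSP, h3, fun x => ?_⟩
  have := hD' x
  simp only [pow_zero] at this
  by_cases hx : x = v
  · simp only [hx, if_true] at this ⊢
    omega
  · simp only [hx, if_false] at this ⊢
    omega

namespace WalkSystem

variable {Ω : Type*} [Fintype Ω] {ℓ ρ k₀ A W m : ℕ} (F : WalkSystem G Ω ℓ ρ k₀ A W m)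

include F

/-- Many good vertices with two pebbles each can send a pebble each to a common good vertex near
the root. -/
lemma solvableAt_of_good {D : V → ℕ} {Y X : Finset V} {r : V}
    (hY : 8 * ℓ * Y.card + 2 ^ ρ < A)
    (hN : 4 * W ^ 3 * (ℓ + 1) * (Y.card + 2 ^ ρ * (3 * ℓ + 1)) < Fintype.card V)
    (hDY : ∀ x ∉ Y, 1 ≤ D x) (hX : X.card = 2 ^ ρ)
    (hXg : ∀ x ∈ X, F.Good Y x) (hDX : ∀ x ∈ X, 2 ≤ D x) :
    SolvableAt G D r := by
  classical
  obtain ⟨g, hg0, hgX, hgood⟩ := F.exists_good Y X r (by omega)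
  set w := F.walk g ρ with hw
  have hU8 : 8 * ℓ * (2 ^ ρ * (3 * ℓ + 1)) ≤ k₀ := by
    refine le_trans ?_ F.k₀_ge
    have h1 : 1 ≤ 2 ^ ρ := Nat.one_le_two_pow
    have h2 : 2 ^ ρ ≤ (2 ^ ρ) ^ 6 := Nat.le_self_pow (by norm_num) _
    calc 8 * ℓ * (2 ^ ρ * (3 * ℓ + 1)) = 2 ^ ρ * (8 * ℓ * (3 * ℓ + 1)) := by ring
      _ ≤ (2 ^ ρ) ^ 6 * (2 ^ 8 * (ℓ + 1) ^ 2) := Nat.mul_le_mul h2 (by nlinarith)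
      _ = _ := by ring
  -- The sources send their pebbles one after another. `U` collects the vertices already used; each
  -- new route avoids `U` and all the other sources, which stay intact until their turn.
  have key : ∀ X' : Finset V, X' ⊆ X → ∃ (D' : V → ℕ) (U : Finset V), Reach G D D' ∧ X'.card ≤ D' w ∧
      U.card ≤ X'.card * (3 * ℓ) ∧ (∀ x ∈ X, x ∉ X' → x ∉ U) ∧
      ∀ x, x ∉ U → D x ≤ D' x := by
    intro X'
    induction X' using Finset.induction_on with
    | empty => exact fun _ => ⟨D, ∅, .refl, by simp, by simp, by simp, fun x _ => le_rfl⟩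
    | insert b X' hb ih =>
      intro hsub
      obtain ⟨D', U, hr, hDw, hUc, hUX, hDU⟩ := ih ((subset_insert _ _).trans hsub)
      have hbX : b ∈ X := hsub (mem_insert_self _ _)
      have hUX' : (U ∪ X).card ≤ 2 ^ ρ * (3 * ℓ + 1) := by
        refine (card_union_le _ _).trans ?_
        have : X'.card ≤ 2 ^ ρ := hX ▸ card_le_card ((subset_insert _ _).trans hsub)
        nlinarith
      have hwi := F.within_of_good (Y := Y) (U := U ∪ X) (hXg b hbX) hgood
        (le_trans (Nat.mul_le_mul_left _ hUX') hU8)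
        (lt_of_le_of_lt (Nat.mul_le_mul_left _ (Nat.add_le_add_left hUX' _)) hN)
      obtain ⟨P₀, hP, hwP, hPc, hPw⟩ := hwi.exists_small
      have hbw : b ≠ w := fun h => hgX (h ▸ hbX)
      have hbU : b ∉ U := hUX b hbX hb
      have hbP : b ∈ P₀ := hPw.mem hbw
      have hP' : ∀ x ∈ P₀, x ≠ b → x ∉ Y ∧ x ∉ U ∧ x ∉ X := by
        intro x hx hxb
        rcases mem_insert.1 (hP hx) with h | h
        · exact absurd h hxb
        · simpa only [mem_compl, mem_union, not_or] using h
      obtain ⟨D'', k, hr', hk, hD''⟩ := exists_reach_gather (G := G) (D := D') (S := {b})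
        (f := id) (a := 0) (j := 3 * ℓ) (P := P₀) (v := w)
        (fun s _ => by simpa using Relation.ReflTransGen.refl) (by simpa using hPw) hwP (by
          intro x
          by_cases hx : x = b
          · subst hx
            have := (hDX x hbX).trans (hDU x hbU)
            simpa [hbP] using this
          · by_cases hxP : x ∈ P₀
            · obtain ⟨h1, h2, h3⟩ := hP' x hxP hx
              simpa [hx, hxP] using (hDY x h1).trans (hDU x h2)
            · simp [hx, hxP])
      have hk1 : 1 ≤ k := by
        by_contra h
        have : k = 0 := by omega
        subst this
        simp at hk
      refine ⟨D'', U ∪ P₀, hr.trans hr', ?_, ?_, ?_, ?_⟩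
      · have := hD'' w
        rw [card_insert_of_notMem hb]
        simp [hwP, hbw.symm] at this
        omega
      · rw [card_insert_of_notMem hb]
        refine (card_union_le _ _).trans ?_
        nlinarith
      · intro x hx hxX'
        rw [mem_insert, not_or] at hxX'
        rw [mem_union, not_or]
        exact ⟨hUX x hx hxX'.2, fun h => (hP' x h hxX'.1).2.2 hx⟩
      · intro x hx
        rw [mem_union, not_or] at hx
        have h1 := hD'' x
        have h2 : x ≠ b := fun h => hx.2 (h ▸ hbP)
        simp [hx.2, h2] at h1
        exact (hDU x hx.1).trans (by omega)
  obtain ⟨D', U, hr, hDw, -⟩ := key X subset_rfl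
  refine SolvableAt.of_reach' hr (SolvableAt.of_single (k := 2 ^ ρ) (v := w) ?_ (hX ▸ hDw))
  have := Reach.single_walk_reverse (F.walk g) ρ fun i hi => F.adj g i (hi.trans_le F.rho_le)
  rwa [hg0] at this

/-- A constant number of pebbles on one vertex suffices if there are few other obstacles. -/
lemma solvableAt_of_const_le {D : V → ℕ} {Y : Finset V} {r v : V}
    (hY : 8 * ℓ * (Y.card + 1) + 2 ^ ρ < A)
    (hN : 4 * W ^ 3 * (ℓ + 1) * (Y.card + 1 + 2 ^ ρ * (3 * ℓ + 1)) < Fintype.card V)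
    (hDY : ∀ x ∉ Y, 1 ≤ D x) (hv : 2 ^ (2 * ρ + 1) ≤ D v) :
    SolvableAt G D r := by
  classical
  have hYv : (insert v Y).card ≤ Y.card + 1 := card_insert_le _ _
  have hY' : 8 * ℓ * (insert v Y).card ≤ 8 * ℓ * (Y.card + 1) := Nat.mul_le_mul_left _ hYv
  -- The pile at `v` puts two pebbles on each of `2 ^ ρ` good vertices at distance at most `ρ`, at
  -- the price `2 ^ (ρ + 1)` each. As `v` may be emptied, it joins the obstacles.
  obtain ⟨X, hXc, hX⟩ := F.exists_good_finset (insert v Y) ∅ v (2 ^ ρ) (by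
    rw [card_empty]; omega)
  have hmove : Reach G (∑ x ∈ X, Pi.single v (2 ^ (ρ + 1))) (∑ x ∈ X, Pi.single x 2) := by
    refine Reach.sum X fun x hx => ?_
    obtain ⟨-, -, g, hg0, hgx⟩ := hX x hx
    have := (Reach.single_walk (F.walk g) ρ
      fun i hi => F.adj g i (hi.trans_le F.rho_le)).nsmul 2
    rw [hg0, hgx, ← Pi.single_smul, ← Pi.single_smul] at this
    rwa [smul_eq_mul, smul_eq_mul, mul_one, ← pow_succ'] at this
  have hsum : ∑ x ∈ X, Pi.single v (2 ^ (ρ + 1)) = (Pi.single v (2 ^ (2 * ρ + 1)) : V → ℕ) := by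
    rw [sum_const, hXc, ← Pi.single_smul, smul_eq_mul, ← pow_add]
    congr 2; ring
  rw [hsum] at hmove
  refine SolvableAt.of_reach (F := D - Pi.single v (2 ^ (2 * ρ + 1))) hmove ?_ ?_
  · funext x
    by_cases hx : x = v
    · subst hx; simp; omega
    · simp [hx]
  refine F.solvableAt_of_good (Y := insert v Y) (X := X) (by omega) (lt_of_le_of_lt ?_ hN) ?_ hXc
    (fun x hx => (hX x hx).2.1) ?_
  · gcongr
  · intro x hx
    rw [mem_insert, not_or] at hx
    have := hDY x hx.2
    simp [hx.1]
    omega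
  · intro x hx
    simp [hx]

open Classical in
/-- Few walks from the sources meet an obstacle early if each obstacle is near few sources. -/
lemma card_early_le {Y S : Finset V} {τ : ℕ} (hSY : Disjoint S Y)
    (hτ : ∀ z ∈ Y, (S.filter fun s => Within G Yᶜ z ρ s).card ≤ τ) :
    (univ.filter fun g => F.walk g 0 ∈ S ∧ ∃ j, j < ρ ∧ F.walk g j ∈ Y).card * k₀ ≤
      ρ * (Y.card * (τ * m)) := by
  have h := F.card_hits_le
    (univ.filter fun g => F.walk g 0 ∈ S ∧ ∃ j, j < ρ ∧ F.walk g j ∈ Y)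
    ((range ρ).erase 0) Y (fun _ z => S.filter fun s => Within G Yᶜ z ρ s) (c := k₀) (b := m)
    (τ := τ) (by
      intro j hj s z
      rw [mem_erase, mem_range] at hj
      exact F.spread_first j (by omega) (by have := F.rho_le; omega) s z)
    (fun _ _ z hz => hτ z hz) (by
      intro g hg
      obtain ⟨-, hs, j, hj, hjY⟩ := mem_filter.1 hg
      -- Up to its first obstacle the walk runs outside `Y`, so its start is one of the few sources
      -- near that obstacle.
      obtain ⟨i, -, hij, hiY, hi⟩ := exists_first_hit (F.walk g) Y (Nat.zero_le j) hjY
      have hi0 : i ≠ 0 := by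
        rintro rfl
        exact disjoint_left.1 hSY hs hiY
      refine ⟨i, by simp; omega, hiY, mem_filter.2 ⟨hs, ?_⟩⟩
      have := Within.of_walk (G := G) (P := Yᶜ) (F.walk g) 0 i
        (fun t _ ht => F.adj g t (by have := F.rho_le; omega))
        (fun t _ ht => mem_compl.2 (hi t (Nat.zero_le _) (by omega)))
      rw [zero_add] at this
      exact this.mono (by omega))
  refine h.trans (Nat.mul_le_mul_right _ ?_)
  exact (card_le_card (erase_subset _ _)).trans_eq (by simp)

open Classical in
lemma card_sources (S : Finset V) :
    (univ.filter fun g => F.walk g 0 ∈ S).card = S.card * m := by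
  rw [← sum_card_fiberwise_eq_card_filter univ S fun g => F.walk g 0,
    sum_congr rfl fun x _ => F.card_eq 0 (Nat.zero_le _) x]
  simp

open Classical in
/-- Too many sources whose walks start out freely cannot exist in an unsolvable distribution. -/
lemma solvableAt_of_sources {D : V → ℕ} {Y S : Finset V} {a : ℕ} {r : V} (haρ : a ≤ ρ)
    (hD : ∀ x, (if x ∈ Y then 0 else 1) + (if x ∈ S then 2 ^ a else 0) ≤ D x)
    (hE : 4 * (univ.filter fun g => F.walk g 0 ∈ S ∧ ∃ j, a ≤ j ∧ j < ρ ∧ F.walk g j ∈ Y).card ≤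
      S.card * m)
    (hY : 4 * (ℓ + 1) * Y.card * (2 ^ ℓ * 2 ^ ℓ) ≤ S.card * A)
    (hS : 2 * (2 ^ ℓ * 2 ^ ℓ) * W < S.card) : SolvableAt G D r := by
  by_contra hun
  have hA : 0 < A := by
    have : Nonempty V := ⟨r⟩
    have hW := F.W_pos
    exact lt_of_lt_of_le (by positivity) F.A_ge
  -- The sources with a walk that is at `z` at step `j` and meets no obstacle from step `a` until
  -- then; the first `a` steps are paid for with `2 ^ a` pebbles and need no relays.
  set src : ℕ → V → Finset V := fun j z => S.filter fun s => ∃ g, F.walk g 0 = s ∧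
    F.walk g j = z ∧ ∀ i, a ≤ i → i < j → F.walk g i ∉ Y with hsrc
  have hcard : ∀ j, ρ ≤ j → j ≤ ℓ → ∀ z, (src j z).card ≤ 2 ^ ℓ * 2 ^ ℓ := by
    intro j hj hjℓ z
    have hex : ∀ s ∈ src j z, ∃ g, F.walk g 0 = s ∧
        F.walk g j = z ∧ ∀ i, a ≤ i → i < j → F.walk g i ∉ Y := fun s hs => (mem_filter.1 hs).2
    have : Nonempty Ω := by
      have h0 := F.card_eq 0 (Nat.zero_le _) r
      obtain ⟨g, -⟩ : (univ.filter fun g => F.walk g 0 = r).Nonempty := by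
        rw [← card_pos, h0]; exact F.m_pos
      exact ⟨g⟩
    choose! γ h0 hz hY using hex
    obtain ⟨D', k, hr, hk, hD'⟩ := exists_reach_gather (G := G) (D := D) (S := src j z)
      (f := fun s => F.walk (γ s) a) (a := a) (j := j - a) (P := Yᶜ.erase z) (v := z)
      (by
        intro s hs
        have := Reach.single_walk (F.walk (γ s)) a fun i hi => F.adj (γ s) i (by omega)
        rwa [h0 s hs] at this)
      (by
        intro s hs
        have := Within.of_walk (G := G) (P := Yᶜ) (F.walk (γ s)) a (j - a)
          (fun i _ hi => F.adj (γ s) i (by omega))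
          (fun i hi hi' => mem_compl.2 (hY s hs i hi (by omega)))
        rw [show a + (j - a) = j by omega, hz s hs] at this
        exact this.erase)
      (by simp)
      (by
        intro x
        refine le_trans (Nat.add_le_add ?_ ?_) (hD x)
        · by_cases hx : x ∈ Y <;> simp [hx]
          split_ifs <;> simp
        · by_cases hx : x ∈ src j z
          · simp [hx, (mem_filter.1 hx).1]
          · simp [hx])
    have hD'z : D' z < 2 ^ ℓ := by
      by_contra h
      exact hun (SolvableAt.of_reach' hr (F.solvableAt_of_le (not_lt.1 h)))
    have h1 := hD' z
    have h2 := hD z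
    have h3 : (if z ∈ src j z then 2 ^ a else 0) ≤ if z ∈ S then 2 ^ a else 0 := by
      by_cases hx : z ∈ src j z
      · simp [hx, (mem_filter.1 hx).1]
      · simp [hx]
    simp only [if_true, mem_erase, ne_eq, not_true_eq_false, false_and, if_false] at h1
    have h4 : k ≤ 2 ^ ℓ := by omega
    exact hk.trans (Nat.mul_le_mul (Nat.pow_le_pow_right (by norm_num) (by omega)) h4)
  set E := univ.filter fun g => F.walk g 0 ∈ S ∧ ∃ j, a ≤ j ∧ j < ρ ∧ F.walk g j ∈ Y with hEdef
  set B := univ.filter fun g => F.walk g 0 ∈ S ∧ ∃ j, ρ ≤ j ∧ j ≤ ℓ ∧ F.walk g j ∈ Y ∧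
    F.walk g 0 ∈ src j (F.walk g j) with hB
  set Γ := univ.filter fun g => F.walk g 0 ∈ S ∧ F.walk g 0 ∈ src ℓ (F.walk g ℓ) with hΓ
  -- Each walk from `S` meets an obstacle in the steps from `a` to `ρ - 1` (`E`), or first meets one
  -- later (`B`), or runs freely to its end (`Γ`). The first two classes make up at most a quarter
  -- each, and the third has at most `4 ^ ℓ * W * m` members.
  have hcover : S.card * m ≤ E.card + B.card + Γ.card := by
    rw [← F.card_sources S]
    have hsub : (univ.filter fun g => F.walk g 0 ∈ S) ⊆ E ∪ B ∪ Γ := by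
      intro g hg
      have hgS := (mem_filter.1 hg).2
      simp only [hEdef, hB, hΓ, mem_union, mem_filter, mem_univ, true_and, hgS]
      by_cases hhit : ∃ j, a ≤ j ∧ j ≤ ℓ ∧ F.walk g j ∈ Y
      · obtain ⟨j, haj, hjℓ, hjY⟩ := hhit
        obtain ⟨i, hai, hij, hiY, hi⟩ := exists_first_hit (F.walk g) Y haj hjY
        left
        by_cases hiρ : i < ρ
        · exact Or.inl ⟨i, hai, hiρ, hiY⟩
        · exact Or.inr ⟨i, by omega, by omega, hiY,
            mem_filter.2 ⟨hgS, g, rfl, rfl, hi⟩⟩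
      · right
        push Not at hhit
        exact mem_filter.2 ⟨hgS, g, rfl, rfl, fun i hi hi' => hhit i hi hi'.le⟩
    exact (card_le_card hsub).trans ((card_union_le _ _).trans
      (Nat.add_le_add_right (card_union_le _ _) _))
  have hBle : 4 * B.card ≤ S.card * m := by
    have := F.card_hits_le B (Icc ρ ℓ) Y src (c := A) (b := m) (τ := 2 ^ ℓ * 2 ^ ℓ)
      (fun j hj s z => F.spread j (mem_Icc.1 hj).1 (mem_Icc.1 hj).2 s z)
      (fun j hj z _ => hcard j (mem_Icc.1 hj).1 (mem_Icc.1 hj).2 z) (by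
        intro g hg
        obtain ⟨-, -, j, h1, h2, h3, h4⟩ := mem_filter.1 hg
        exact ⟨j, mem_Icc.2 ⟨h1, h2⟩, h3, h4⟩)
    have h1 : (Icc ρ ℓ).card ≤ ℓ + 1 := by simp
    have h2 : 4 * B.card * A ≤ S.card * m * A := by
      calc 4 * B.card * A = 4 * (B.card * A) := by ring
        _ ≤ 4 * ((ℓ + 1) * (Y.card * (2 ^ ℓ * 2 ^ ℓ * m))) := by
            refine Nat.mul_le_mul_left _ (this.trans (Nat.mul_le_mul_right _ h1))
        _ = 4 * (ℓ + 1) * Y.card * (2 ^ ℓ * 2 ^ ℓ) * m := by ring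
        _ ≤ S.card * A * m := Nat.mul_le_mul_right _ hY
        _ = _ := by ring
    exact Nat.le_of_mul_le_mul_right h2 hA
  have hΓle : Γ.card ≤ 2 ^ ℓ * 2 ^ ℓ * W * m := by
    have := F.card_hits_le Γ {ℓ} univ src (c := Fintype.card V) (b := W * m)
      (τ := 2 ^ ℓ * 2 ^ ℓ) (by
        intro j hj s z
        obtain rfl := mem_singleton.1 hj
        exact F.spread_last s z) (by
        intro j hj z _
        obtain rfl := mem_singleton.1 hj
        exact hcard _ F.rho_le le_rfl z) (by
        intro g hg
        exact ⟨ℓ, by simp, mem_univ _, (mem_filter.1 hg).2.2⟩)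
    have h1 : Γ.card * Fintype.card V ≤ 2 ^ ℓ * 2 ^ ℓ * W * m * Fintype.card V := by
      rw [card_singleton, one_mul, card_univ] at this
      exact this.trans_eq (by ring)
    exact Nat.le_of_mul_le_mul_right h1 (Fintype.card_pos_iff.2 ⟨r⟩)
  have h1 : S.card * m ≤ 2 * (2 ^ ℓ * 2 ^ ℓ) * W * m := by
    have : 2 * (2 ^ ℓ * 2 ^ ℓ) * W * m = 2 * (2 ^ ℓ * 2 ^ ℓ * W * m) := by ring
    omega
  have := Nat.le_of_mul_le_mul_right h1 F.m_pos
  omega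

end WalkSystem

end ClassZero

end Pebbling

namespace Pebbling

open Finset

/-! ### Distributions with few empty vertices. -/

section ClassZero

variable {V : Type*} [DecidableEq V] [Fintype V] {G : SimpleGraph V}

omit [DecidableEq V] in
-- The average is one pebble per vertex, so surplus and deficit balance.
lemma sum_excess_eq {D : V → ℕ} (hD : ∑ x, D x = Fintype.card V) :
    ∑ x ∈ univ.filter (fun x => 2 ≤ D x), (D x - 1) = (univ.filter fun x => D x = 0).card := by
  have h : ∑ x, (D x + if D x = 0 then 1 else 0) =
      ∑ x, (1 + if 2 ≤ D x then D x - 1 else 0) := by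
    refine sum_congr rfl fun x _ => ?_
    split_ifs <;> omega
  rw [sum_add_distrib, sum_add_distrib, hD, ← sum_filter, ← sum_filter] at h
  simp only [sum_const, smul_eq_mul, mul_one, card_univ] at h
  omega

namespace WalkSystem

variable {Ω : Type*} [Fintype Ω] {ℓ ρ k₀ A W m : ℕ} (F : WalkSystem G Ω ℓ ρ k₀ A W m)

include F

/-- Obstacle sets of moderate size satisfy the numerical assumptions of
`solvableAt_of_const_le`. -/
lemma small_bounds [Nonempty V] {y : ℕ}
    (hy : y ≤ 2 * (2 ^ 8 * (2 ^ ρ) ^ 6 * (2 ^ ℓ) ^ 3 * W)) :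
    8 * ℓ * (y + 1) + 2 ^ ρ < A ∧
      4 * W ^ 3 * (ℓ + 1) * (y + 1 + 2 ^ ρ * (3 * ℓ + 1)) < Fintype.card V := by
  have hN := F.A_le_card
  have hA := F.A_ge
  have hW : 1 ≤ W := F.W_pos
  have hT : 1 ≤ 2 ^ ρ := Nat.one_le_two_pow
  have hℓ : ℓ + 1 ≤ 2 ^ ℓ := Nat.lt_two_pow_self
  generalize 2 ^ ρ = T at *
  generalize 2 ^ ℓ = Q at *
  have hQ : 1 ≤ Q := by omega
  set Θ := 2 ^ 8 * T ^ 6 * Q ^ 3 * W with hΘ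
  have hTQ : T * Q ≤ Θ := by
    calc T * Q = 1 * T ^ 1 * Q ^ 1 * 1 := by ring
      _ ≤ 2 ^ 8 * T ^ 6 * Q ^ 3 * W := by gcongr <;> norm_num
  have hTQ1 : 1 ≤ T * Q := Nat.mul_pos hT hQ
  have hTT : T ≤ T * Q := Nat.le_mul_of_pos_right _ hQ
  constructor
  · calc 8 * ℓ * (y + 1) + T ≤ 8 * Q * (3 * Θ) + Q * Θ := by
          have h1 : 8 * ℓ * (y + 1) ≤ 8 * Q * (3 * Θ) := by
            gcongr <;> omega
          have h2 : Θ ≤ Q * Θ := Nat.le_mul_of_pos_left _ hQ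
          omega
      _ < 64 * Q * Θ := by nlinarith [Nat.mul_pos hQ (hTQ1.trans hTQ)]
      _ = 2 ^ 14 * T ^ 6 * Q ^ 4 * W ^ 1 := by rw [hΘ]; ring
      _ ≤ 2 ^ 14 * T ^ 8 * Q ^ 6 * W ^ 4 := by gcongr <;> norm_num
      _ ≤ A := hA
  · calc 4 * W ^ 3 * (ℓ + 1) * (y + 1 + T * (3 * ℓ + 1))
        ≤ 4 * W ^ 3 * Q * (2 * Θ + Θ + 3 * Θ) := by
          have h1 : T * (3 * ℓ + 1) ≤ 3 * Θ := by
            have : T * (3 * ℓ + 1) ≤ T * (3 * Q) := Nat.mul_le_mul_left _ (by omega)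
            linarith
          gcongr
          omega
      _ = 24 * (2 ^ 8 * T ^ 6 * Q ^ 4 * W ^ 4) := by rw [hΘ]; ring
      _ < 64 * (2 ^ 8 * T ^ 6 * Q ^ 4 * W ^ 4) := by
          have : 0 < 2 ^ 8 * T ^ 6 * Q ^ 4 * W ^ 4 := by positivity
          omega
      _ = 2 ^ 14 * T ^ 6 * Q ^ 4 * W ^ 4 := by ring
      _ ≤ 2 ^ 14 * T ^ 8 * Q ^ 6 * W ^ 4 := by gcongr <;> norm_num
      _ ≤ A := hA
      _ ≤ _ := hN

open Classical in
/-- If every obstacle is near few of the sources and there are not too many obstacles, then most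
sources are good. -/
lemma card_sources_not_good_le [Nonempty V] {Y S : Finset V} (hSY : Disjoint S Y)
    (hτ : ∀ z ∈ Y, (S.filter fun s => Within G Yᶜ z ρ s).card ≤ 2 * (2 ^ ρ) ^ 3)
    (hYS : Y.card ≤ 2 * (2 ^ ρ) ^ 2 * S.card)
    (hY : Y.card ≤ 2 ^ 8 * (2 ^ ρ) ^ 6 * (2 ^ ℓ) ^ 3 * W) :
    2 * (S.filter fun s => ¬ F.Good Y s).card ≤ S.card := by
  have hk : 0 < k₀ := lt_of_lt_of_le (by positivity) F.k₀_ge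
  have hW : 0 < W := F.W_pos
  have hA : 0 < A := lt_of_lt_of_le (by positivity) F.A_ge
  have hρT : ρ ≤ 2 ^ ρ := Nat.lt_two_pow_self.le
  have hT : 1 ≤ 2 ^ ρ := Nat.one_le_two_pow
  have hℓ : ℓ + 1 ≤ 2 ^ ℓ := Nat.lt_two_pow_self
  have hQ : 1 ≤ 2 ^ ℓ := Nat.one_le_two_pow
  set E := univ.filter fun g => F.walk g 0 ∈ S ∧ ∃ j, j < ρ ∧ F.walk g j ∈ Y with hEdef
  set B := univ.filter fun g => F.walk g 0 ∈ S ∧ ∃ j, ρ ≤ j ∧ j ≤ ℓ ∧ F.walk g j ∈ Y with hBdef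
  have hE : 32 * E.card ≤ S.card * m := by
    have h1 := F.card_early_le hSY hτ
    have h2 : 32 * E.card * k₀ ≤ S.card * m * k₀ := by
      calc 32 * E.card * k₀ = 32 * (E.card * k₀) := by ring
        _ ≤ 32 * (2 ^ ρ * ((2 * (2 ^ ρ) ^ 2 * S.card) * (2 * (2 ^ ρ) ^ 3 * m))) :=
            Nat.mul_le_mul_left _ (h1.trans (by gcongr))
        _ = (2 ^ 7 * (2 ^ ρ) ^ 6 * 1 ^ 2) * (S.card * m) := by ring
        _ ≤ k₀ * (S.card * m) := by
            refine Nat.mul_le_mul_right _ (le_trans ?_ F.k₀_ge)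
            gcongr
            · norm_num
            · norm_num
            · omega
        _ = _ := by ring
    exact Nat.le_of_mul_le_mul_right h2 hk
  have hB : 32 * B.card ≤ S.card * m := by
    have h1 := F.card_hits_le B (Icc ρ ℓ) Y (fun _ _ => S) (c := A) (b := m) (τ := S.card)
      (fun j hj s z => F.spread j (mem_Icc.1 hj).1 (mem_Icc.1 hj).2 s z)
      (fun _ _ _ _ => le_rfl) (by
        intro g hg
        obtain ⟨-, h1, j, h2, h3, h4⟩ := mem_filter.1 hg
        exact ⟨j, mem_Icc.2 ⟨h2, h3⟩, h4, h1⟩)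
    have h2 : (Icc ρ ℓ).card ≤ 2 ^ ℓ := by simp; omega
    have h3 : 32 * B.card * A ≤ S.card * m * A := by
      calc 32 * B.card * A = 32 * (B.card * A) := by ring
        _ ≤ 32 * (2 ^ ℓ * ((2 ^ 8 * (2 ^ ρ) ^ 6 * (2 ^ ℓ) ^ 3 * W) * (S.card * m))) :=
            Nat.mul_le_mul_left _ (h1.trans (by gcongr))
        _ = (2 ^ 13 * (2 ^ ρ) ^ 6 * (2 ^ ℓ) ^ 4 * W ^ 1) * (S.card * m) := by ring
        _ ≤ A * (S.card * m) := by
            refine Nat.mul_le_mul_right _ (le_trans ?_ F.A_ge)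
            gcongr <;> norm_num
        _ = _ := by ring
    exact Nat.le_of_mul_le_mul_right h3 hA
  -- Each source that is not good has more than `m / 8` walks in `E ∪ B`. With the two bounds `|S| *
  -- m / 32` this leaves at most half of the sources.
  have hbad : (S.filter fun s => ¬ F.Good Y s).card * m ≤ 8 * (E.card + B.card) := by
    set H := univ.filter fun g => F.walk g 0 ∈ S ∧ ∃ j, 1 ≤ j ∧ j ≤ ℓ ∧ F.walk g j ∈ Y with hH
    have hHle : H.card ≤ E.card + B.card := by
      refine (card_le_card ?_).trans (card_union_le E B)
      intro g hg
      obtain ⟨-, h1, j, h2, h3, h4⟩ := mem_filter.1 hg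
      by_cases hj : j < ρ
      · exact mem_union_left _ (mem_filter.2 ⟨mem_univ _, h1, j, hj, h4⟩)
      · exact mem_union_right _ (mem_filter.2 ⟨mem_univ _, h1, j, by omega, h3, h4⟩)
    refine le_trans ?_ (Nat.mul_le_mul_left 8 hHle)
    rw [← smul_eq_mul]
    refine (card_nsmul_le_sum _ (fun x => 8 * (H.filter fun g => F.walk g 0 = x).card) m ?_).trans
      ?_
    · intro x hx
      obtain ⟨hxS, hx⟩ := mem_filter.1 hx
      simp only [Good, not_le] at hx
      refine hx.le.trans (Nat.mul_le_mul_left _ (card_le_card ?_))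
      intro g hg
      obtain ⟨-, h1, h2⟩ := mem_filter.1 hg
      exact mem_filter.2 ⟨mem_filter.2 ⟨mem_univ _, h1 ▸ hxS, h2⟩, h1⟩
    · rw [← mul_sum]
      refine Nat.mul_le_mul_left _ ?_
      rw [sum_card_fiberwise_eq_card_filter]
      exact card_le_card (filter_subset _ _)
  have h4 : 2 * (S.filter fun s => ¬ F.Good Y s).card * m ≤ S.card * m := by
    rw [mul_assoc]; omega
  exact Nat.le_of_mul_le_mul_right h4 F.m_pos

/-- Two good vertices: a second pebble on one of them lets us reach the other. -/
lemma solvableAt_of_good_root {D : V → ℕ} {b r : V}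
    (hb : F.Good (univ.filter fun x => D x = 0) b) (hr : F.Good (univ.filter fun x => D x = 0) r)
    (hN : 4 * W ^ 3 * (ℓ + 1) * (univ.filter fun x => D x = 0).card < Fintype.card V)
    (hDb : 2 ≤ D b) : SolvableAt G D r := by
  classical
  by_cases hbr : b = r
  · exact ⟨D, .refl, by subst hbr; omega⟩
  have hw := F.within_of_good (Y := univ.filter fun x => D x = 0) (U := ∅) hb hr (by simp)
    (by simpa using hN)
  obtain ⟨D', k, h1, h2, h3⟩ := exists_reach_gather (G := G) (D := D) (S := {b}) (f := id)
    (a := 0) (j := 3 * ℓ) (v := r)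
    (P := (insert b ((univ.filter fun x => D x = 0) ∪ ∅)ᶜ).erase r)
    (fun s _ => by simpa using Relation.ReflTransGen.refl) (by simpa using hw.erase) (by simp) (by
      intro x
      by_cases hx : x = b
      · subst hx; simp [hbr, hDb]
      · by_cases hx0 : D x = 0
        · simp [hx, hx0]
        · simp only [mem_erase, mem_insert, hx, false_or, mem_singleton, if_false, add_zero]
          split_ifs <;> omega)
  have hk : 1 ≤ k := by
    by_contra h
    obtain rfl : k = 0 := by omega
    simp at h2
  have h4 := h3 r
  simp [Ne.symm hbr] at h4
  exact ⟨D', h1, by omega⟩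

/-- Distributions with few empty vertices are solvable. -/
lemma solvableAt_of_card_zero_le {D : V → ℕ} (hD : ∑ x, D x = Fintype.card V) (r : V)
    (hZ : (univ.filter fun x => D x = 0).card ≤ 2 ^ 8 * (2 ^ ρ) ^ 6 * (2 ^ ℓ) ^ 3 * W) :
    SolvableAt G D r := by
  classical
  have : Nonempty V := ⟨r⟩
  by_contra hun
  set Z := univ.filter fun x => D x = 0 with hZdef
  set B := univ.filter fun x => 2 ≤ D x with hBdef
  have hDZ : ∀ x ∉ Z, 1 ≤ D x := by
    intro x hx
    have : D x ≠ 0 := fun h => hx (by simp [hZdef, h])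
    omega
  have hDB : ∀ x ∈ B, 2 ≤ D x := fun x hx => (mem_filter.1 hx).2
  have hBZ : Disjoint B Z := disjoint_left.2 fun x hx hx' => by
    have h1 := hDB x hx
    have h2 := (mem_filter.1 hx').2
    omega
  have hK : 2 ^ (2 * ρ + 1) = 2 * (2 ^ ρ) ^ 2 := by rw [pow_succ, pow_mul']; ring
  have hT : 1 ≤ 2 ^ ρ := Nat.one_le_two_pow
  have hρT : ρ ≤ 2 ^ ρ := Nat.lt_two_pow_self.le
  have hQ : 1 ≤ 2 ^ ℓ := Nat.one_le_two_pow
  have hW : 1 ≤ W := F.W_pos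
  have hb1 := F.small_bounds (y := Z.card) (by omega)
  have hconst : ∀ v, D v < 2 * (2 ^ ρ) ^ 2 := by
    intro v
    by_contra h
    rw [← hK, not_lt] at h
    exact hun (F.solvableAt_of_const_le hb1.1 hb1.2 hDZ h)
  have hZB : Z.card ≤ 2 * (2 ^ ρ) ^ 2 * B.card := by
    rw [hZdef, ← sum_excess_eq hD, mul_comm, ← smul_eq_mul]
    refine sum_le_card_nsmul _ _ _ fun x _ => ?_
    have := hconst x
    omega
  -- Otherwise `2 * (2 ^ ρ) ^ 3` sources within distance `ρ` of `z` would gather `2 * (2 ^ ρ) ^ 2`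
  -- pebbles there, a pile that suffices on its own even with the spent vertices as further
  -- obstacles.
  have hnear : ∀ z ∈ Z, (B.filter fun s => Within G Zᶜ z ρ s).card ≤ 2 * (2 ^ ρ) ^ 3 := by
    intro z hz
    by_contra hcon
    obtain ⟨S, hS, hSc⟩ := exists_subset_card_eq (not_le.1 hcon).le
    have hSB : ∀ s ∈ S, s ∈ B := fun s hs => (mem_filter.1 (hS hs)).1
    obtain ⟨D', P₀, hr, hPZ, -, hSP, hPc, hD'⟩ := exists_reach_collect (G := G) (D := D) (Y := Z)
      (S := S) (v := z) (i := ρ) (k := 2 ^ (2 * ρ + 1)) hDZ (fun s hs => hDB s (hSB s hs))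
      (fun h => disjoint_left.1 hBZ (hSB z h) hz) (fun s hs => (mem_filter.1 (hS hs)).2)
      (by rw [hSc, hK]; exact le_of_eq (by ring))
    have hzP : z ∉ P₀ := fun h => disjoint_left.1 hPZ h hz
    have hzS : z ∉ S := fun h => disjoint_left.1 hBZ (hSB z h) hz
    have hYc : (Z ∪ P₀).card ≤ 2 * (2 ^ 8 * (2 ^ ρ) ^ 6 * (2 ^ ℓ) ^ 3 * W) := by
      refine (card_union_le _ _).trans ?_
      have h1 : P₀.card ≤ 2 ^ 8 * (2 ^ ρ) ^ 6 * (2 ^ ℓ) ^ 3 * W := by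
        rw [hSc] at hPc
        calc P₀.card ≤ 2 * (2 ^ ρ) ^ 3 * 2 ^ ρ := hPc.trans (Nat.mul_le_mul_left _ hρT)
          _ = 2 * (2 ^ ρ) ^ 4 * 1 ^ 3 * 1 := by ring
          _ ≤ _ := by gcongr <;> norm_num
      omega
    have hb2 := F.small_bounds hYc
    refine hun (SolvableAt.of_reach' hr (F.solvableAt_of_const_le (v := z) hb2.1 hb2.2 ?_ ?_))
    · intro x hx
      rw [mem_union, not_or] at hx
      have h1 := hD' x
      have h2 := hDZ x hx.1
      have h3 : x ∉ S := fun h => hx.2 (hSP h)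
      simp [hx.2, h3] at h1
      omega
    · have := hD' z
      simp [hzP, hzS] at this
      omega
  have hgood := F.card_sources_not_good_le hBZ hnear hZB hZ
  have hBsmall : B.card < 2 * 2 ^ ρ := by
    by_contra hcon
    have hsplit := card_filter_add_card_filter_not (s := B) (fun s => F.Good Z s)
    obtain ⟨X, hX, hXc⟩ := exists_subset_card_eq
      (show 2 ^ ρ ≤ (B.filter fun s => F.Good Z s).card by omega)
    refine hun (F.solvableAt_of_good (Y := Z) (X := X) ?_ ?_ hDZ hXc
      (fun x hx => (mem_filter.1 (hX hx)).2) fun x hx => hDB x (mem_filter.1 (hX hx)).1)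
    · exact lt_of_le_of_lt (Nat.add_le_add_right (Nat.mul_le_mul_left _ (Nat.le_succ _)) _) hb1.1
    · exact lt_of_le_of_lt (Nat.mul_le_mul_left _ (Nat.add_le_add_right (Nat.le_succ _) _)) hb1.2
  -- With so few sources there are at most `4 * (2 ^ ρ) ^ 3` empty vertices. The spread `k₀` alone
  -- then makes every vertex good, including the root, and a single source can reach it.
  have hall : ∀ x, F.Good Z x := by
    intro x
    have hk : 0 < k₀ := lt_of_lt_of_le (by positivity) F.k₀_ge
    have h1 := F.card_hits_le
      (univ.filter fun g => F.walk g 0 = x ∧ ∃ j, 1 ≤ j ∧ j ≤ ℓ ∧ F.walk g j ∈ Z) (Icc 1 ℓ) Z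
      (fun _ _ => {x}) (c := k₀) (b := m) (τ := 1)
      (fun j hj s z => F.spread_first j (mem_Icc.1 hj).1 (mem_Icc.1 hj).2 s z) (by simp) (by
        intro g hg
        obtain ⟨-, hg0, j, hj1, hj2, hj⟩ := mem_filter.1 hg
        exact ⟨j, mem_Icc.2 ⟨hj1, hj2⟩, hj, by simpa using hg0⟩)
    simp only [Nat.card_Icc, add_tsub_cancel_right, one_mul] at h1
    have h2 : Z.card ≤ 4 * (2 ^ ρ) ^ 3 := by
      calc Z.card ≤ 2 * (2 ^ ρ) ^ 2 * (2 * 2 ^ ρ) := hZB.trans (Nat.mul_le_mul_left _ hBsmall.le)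
        _ = _ := by ring
    have h3 : 8 * (ℓ * Z.card) ≤ k₀ := by
      calc 8 * (ℓ * Z.card) ≤ 8 * ((ℓ + 1) * (4 * (2 ^ ρ) ^ 3)) := by gcongr; omega
        _ = 2 ^ 5 * (2 ^ ρ) ^ 3 * (ℓ + 1) ^ 1 := by ring
        _ ≤ 2 ^ 8 * (2 ^ ρ) ^ 6 * (ℓ + 1) ^ 2 := by gcongr <;> omega
        _ ≤ k₀ := F.k₀_ge
    unfold Good
    refine Nat.le_of_mul_le_mul_right ?_ hk
    calc _ = 8 * ((univ.filter fun g => F.walk g 0 = x ∧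
          ∃ j, 1 ≤ j ∧ j ≤ ℓ ∧ F.walk g j ∈ Z).card * k₀) := by ring
      _ ≤ 8 * (ℓ * (Z.card * m)) := Nat.mul_le_mul_left _ h1
      _ = 8 * (ℓ * Z.card) * m := by ring
      _ ≤ k₀ * m := Nat.mul_le_mul_right _ h3
      _ = m * k₀ := mul_comm _ _
  have hrZ : r ∈ Z := by
    by_contra h
    exact hun ⟨D, .refl, hDZ r h⟩
  obtain ⟨b, hb⟩ : B.Nonempty := by
    rw [← card_pos]
    by_contra h
    have h0 : B.card = 0 := by omega
    rw [h0, mul_zero] at hZB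
    have := card_pos.2 ⟨r, hrZ⟩
    omega
  refine hun (F.solvableAt_of_good_root (hall b) (hall r) ?_ (hDB b hb))
  refine lt_of_le_of_lt (Nat.mul_le_mul_left _ ?_) hb1.2
  rw [← hZdef]
  omega

end WalkSystem

end ClassZero

end Pebbling

namespace Pebbling

open Finset

/-! ### Distributions with many empty vertices, and the abstract Class 0 theorem. -/

section ClassZero

variable {V : Type*} [DecidableEq V] [Fintype V] {G : SimpleGraph V}

namespace WalkSystem

variable {Ω : Type*} [Fintype Ω] {ℓ ρ k₀ A W m : ℕ} (F : WalkSystem G Ω ℓ ρ k₀ A W m)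

include F

/-- Many sources with a constant number of pebbles each, at a moderate number of obstacles. -/
lemma solvableAt_of_many_const {D : V → ℕ} {Y S : Finset V} {r : V}
    (hDY : ∀ x ∉ Y, 1 ≤ D x) (hDS : ∀ x ∈ S, x ∈ Y → 2 ^ ρ ≤ D x)
    (hDS' : ∀ x ∈ S, x ∉ Y → 2 ^ ρ + 1 ≤ D x)
    (hY : Y.card ≤ 2 ^ 10 * (2 ^ ρ) ^ 6 * 2 ^ ℓ * S.card)
    (hS : 2 * (2 ^ ℓ * 2 ^ ℓ) * W < S.card) : SolvableAt G D r := by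
  classical
  have : Nonempty V := ⟨r⟩
  have hW : 1 ≤ W := F.W_pos
  have hT : 1 ≤ 2 ^ ρ := Nat.one_le_two_pow
  have hQ : 1 ≤ 2 ^ ℓ := Nat.one_le_two_pow
  have hℓ : ℓ + 1 ≤ 2 ^ ℓ := Nat.lt_two_pow_self
  refine F.solvableAt_of_sources (Y := Y) (S := S) (a := ρ) le_rfl ?_ ?_ ?_ hS
  · intro x
    by_cases hxY : x ∈ Y <;> by_cases hxS : x ∈ S
    · simpa [hxY, hxS] using hDS x hxS hxY
    · simp [hxY, hxS]
    · simpa [hxY, hxS, add_comm] using hDS' x hxS hxY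
    · simpa [hxY, hxS] using hDY x hxY
  -- With `a = ρ` the range `a ≤ j < ρ` of early hits is empty.
  · rw [filter_false_of_mem]
    · simp
    · rintro g - ⟨-, j, h1, h2, -⟩
      omega
  · calc 4 * (ℓ + 1) * Y.card * (2 ^ ℓ * 2 ^ ℓ)
        ≤ 4 * 2 ^ ℓ * (2 ^ 10 * (2 ^ ρ) ^ 6 * 2 ^ ℓ * S.card) * (2 ^ ℓ * 2 ^ ℓ) := by gcongr
      _ = S.card * (2 ^ 12 * (2 ^ ρ) ^ 6 * (2 ^ ℓ) ^ 4 * 1 ^ 4) := by ring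
      _ ≤ S.card * (2 ^ 14 * (2 ^ ρ) ^ 8 * (2 ^ ℓ) ^ 6 * W ^ 4) := by gcongr <;> norm_num
      _ ≤ S.card * A := Nat.mul_le_mul_left _ F.A_ge

/-- Many sources with two pebbles each, each obstacle being near few of them. -/
lemma solvableAt_of_many_two {D : V → ℕ} {Y S : Finset V} {r : V}
    (hSY : Disjoint S Y) (hDY : ∀ x ∉ Y, 1 ≤ D x) (hDS : ∀ x ∈ S, 2 ≤ D x)
    (hnear : ∀ z ∈ Y, ∀ S' ⊆ S, (∀ s ∈ S', Within G Yᶜ z ρ s) → S'.card ≤ 2 * (2 ^ ρ) ^ 3)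
    (hY : Y.card ≤ 12 * (2 ^ ρ) ^ 2 * S.card)
    (hS : 2 * (2 ^ ℓ * 2 ^ ℓ) * W < S.card) : SolvableAt G D r := by
  classical
  have : Nonempty V := ⟨r⟩
  have hW : 1 ≤ W := F.W_pos
  have hT : 1 ≤ 2 ^ ρ := Nat.one_le_two_pow
  have hρT : ρ ≤ 2 ^ ρ := Nat.lt_two_pow_self.le
  have hQ : 1 ≤ 2 ^ ℓ := Nat.one_le_two_pow
  have hℓ : ℓ + 1 ≤ 2 ^ ℓ := Nat.lt_two_pow_self
  have hk : 0 < k₀ := lt_of_lt_of_le (by positivity) F.k₀_ge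
  refine F.solvableAt_of_sources (Y := Y) (S := S) (a := 0) (Nat.zero_le _) ?_ ?_ ?_ hS
  · intro x
    by_cases hxS : x ∈ S
    · simpa [disjoint_left.1 hSY hxS, hxS] using hDS x hxS
    · by_cases hxY : x ∈ Y
      · simp [hxY, hxS]
      · simpa [hxY, hxS] using hDY x hxY
  · have h1 := F.card_early_le hSY (τ := 2 * (2 ^ ρ) ^ 3) fun z hz =>
      hnear z hz _ (filter_subset _ _) fun s hs => (mem_filter.1 hs).2
    simp only [Nat.zero_le, true_and]
    refine Nat.le_of_mul_le_mul_right ?_ hk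
    rw [mul_assoc]
    calc _ ≤ 4 * (2 ^ ρ * ((12 * (2 ^ ρ) ^ 2 * S.card) * (2 * (2 ^ ρ) ^ 3 * m))) :=
          Nat.mul_le_mul_left _ (h1.trans (by gcongr))
      _ = (96 * (2 ^ ρ) ^ 6 * 1 ^ 2) * (S.card * m) := by ring
      _ ≤ (2 ^ 8 * (2 ^ ρ) ^ 6 * (ℓ + 1) ^ 2) * (S.card * m) := by
          gcongr
          · norm_num
          · omega
      _ ≤ k₀ * (S.card * m) := Nat.mul_le_mul_right _ F.k₀_ge
      _ = _ := by ring
  · calc 4 * (ℓ + 1) * Y.card * (2 ^ ℓ * 2 ^ ℓ)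
        ≤ 4 * 2 ^ ℓ * (12 * (2 ^ ρ) ^ 2 * S.card) * (2 ^ ℓ * 2 ^ ℓ) := by gcongr
      _ = S.card * (48 * (2 ^ ρ) ^ 2 * (2 ^ ℓ) ^ 3 * 1 ^ 4) := by ring
      _ ≤ S.card * (2 ^ 14 * (2 ^ ρ) ^ 8 * (2 ^ ℓ) ^ 6 * W ^ 4) := by gcongr <;> norm_num
      _ ≤ S.card * A := Nat.mul_le_mul_left _ F.A_ge

/-- Distributions with many empty vertices are solvable. -/
lemma solvableAt_of_card_zero_gt {D : V → ℕ} (hD : ∑ x, D x = Fintype.card V) (r : V)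
    (hZ : 2 ^ 8 * (2 ^ ρ) ^ 6 * (2 ^ ℓ) ^ 3 * W < (univ.filter fun x => D x = 0).card) :
    SolvableAt G D r := by
  classical
  by_contra hun
  have hne : Nonempty V := ⟨r⟩
  set Z := univ.filter fun x => D x = 0 with hZdef
  set B := univ.filter fun x => 2 ≤ D x with hBdef
  set K := 2 * (2 ^ ρ) ^ 2 with hKdef
  -- `K` is the size of a pile. `u` bounds the vertices spent on one pile: `2 * (2 ^ ρ) ^ 3` sources
  -- with at most `ρ ≤ 2 ^ ρ` vertices each.
  set u := 2 * (2 ^ ρ) ^ 4 with hudef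
  have hW : 1 ≤ W := F.W_pos
  have hT : 1 ≤ 2 ^ ρ := Nat.one_le_two_pow
  have hρT : ρ ≤ 2 ^ ρ := Nat.lt_two_pow_self.le
  have hQ : 1 ≤ 2 ^ ℓ := Nat.one_le_two_pow
  have hu : 0 < u := by positivity
  have hKρ : 2 ^ ρ + 1 ≤ K := by
    rw [hKdef]; nlinarith
  have hDZ : ∀ x ∉ Z, 1 ≤ D x := by
    intro x hx
    have : D x ≠ 0 := fun h => hx (by simp [hZdef, h])
    omega
  have hZD : ∀ x ∈ Z, D x = 0 := fun x hx => (mem_filter.1 hx).2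
  have hDB : ∀ x ∈ B, 2 ≤ D x := fun x hx => (mem_filter.1 hx).2
  have hbig : ∀ D' : V → ℕ, Reach G D D' → ∀ x, D' x < 2 ^ ℓ := by
    intro D' hr x
    by_contra h
    exact hun (SolvableAt.of_reach' hr (F.solvableAt_of_le (not_lt.1 h)))
  set H := B.filter fun x => K ≤ D x with hHdef
  have hmass : Z.card ≤ 2 ^ ℓ * H.card + K * B.card := by
    rw [hZdef, ← sum_excess_eq hD, ← sum_filter_add_sum_filter_not B fun x => K ≤ D x]
    refine Nat.add_le_add ?_ ?_
    · rw [mul_comm, ← smul_eq_mul]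
      refine sum_le_card_nsmul _ _ _ fun x _ => ?_
      have := hbig D .refl x
      omega
    · refine (sum_le_card_nsmul _ _ K fun x hx => ?_).trans ?_
      · have := (mem_filter.1 hx).2
        omega
      · rw [smul_eq_mul, mul_comm]
        exact Nat.mul_le_mul_left _ (card_le_card (filter_subset _ _))
  -- Either the vertices that already own a pile are numerous enough to be the sources, or the
  -- number of empty vertices is bounded by a multiple of `|B|` that does not involve `ℓ`.
  by_cases hH : Z.card ≤ 2 * 2 ^ ℓ * H.card
  · refine hun (F.solvableAt_of_many_const (Y := Z) (S := H) hDZ ?_ ?_ ?_ ?_)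
    · intro x hx _
      have := (mem_filter.1 hx).2
      omega
    · intro x hx _
      have := (mem_filter.1 hx).2
      omega
    · calc Z.card ≤ 2 * 1 ^ 6 * 2 ^ ℓ * H.card := by simpa using hH
        _ ≤ _ := by gcongr; norm_num
    · have h1 := hZ.trans_le hH
      have h2 : 2 * 2 ^ ℓ * (2 * (2 ^ ℓ * 2 ^ ℓ) * W) < 2 * 2 ^ ℓ * H.card := by
        refine lt_of_le_of_lt ?_ h1
        calc _ = 4 * 1 ^ 6 * (2 ^ ℓ) ^ 3 * W := by ring
          _ ≤ _ := by gcongr; norm_num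
      exact Nat.lt_of_mul_lt_mul_left h2
  have hZB : Z.card ≤ 2 * K * B.card := by
    rw [not_le] at hH
    nlinarith
  have hBlarge : 2 ^ 6 * (2 ^ ρ) ^ 4 * (2 ^ ℓ) ^ 3 * W < B.card := by
    have h1 := hZ.trans_le hZB
    have h2 : 2 * K * (2 ^ 6 * (2 ^ ρ) ^ 4 * (2 ^ ℓ) ^ 3 * W) < 2 * K * B.card := by
      refine lt_of_le_of_lt (le_of_eq ?_) h1
      rw [hKdef]; ring
    exact Nat.lt_of_mul_lt_mul_left h2
  -- It is possible to collect `p` piles, `n x` of them at `x`, spending original pebbles only at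
  -- vertices of `X`.
  set Inv : ℕ → Prop := fun p => ∃ (D' n : V → ℕ) (X : Finset V), Reach G D D' ∧ ∑ x, n x = p ∧
    X.card ≤ u * p ∧ ∀ x, K * n x + (if x ∈ X then 0 else D x) ≤ D' x with hInv
  have h0 : Inv 0 := ⟨D, 0, ∅, .refl, by simp, by simp, by simp⟩
  -- As long as at most `q` piles have been collected, at least half of `B` is unspent.
  set q := B.card / (2 * u) with hq
  have hq1 : B.card < 2 * u * (q + 1) := by
    exact Nat.lt_mul_div_succ _ (by omega)
  have hq2 : 2 * u * q ≤ B.card := Nat.mul_div_le _ _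
  by_cases hend : Inv q
  · obtain ⟨D', n, X, hr, hn, hX, hD'⟩ := hend
    set S := univ.filter fun x => 1 ≤ n x with hSdef
    -- No vertex can hold `2 ^ ℓ` pebbles, so the piles lie on many different vertices.
    have hqS : q ≤ 2 ^ ℓ * S.card := by
      rw [← hn, mul_comm, ← smul_eq_mul]
      have : ∑ x, n x = ∑ x ∈ S, n x := by
        refine (sum_subset (subset_univ _) fun x _ hx => ?_).symm
        have : ¬ 1 ≤ n x := fun h => hx (by simp [hSdef, h])
        omega
      rw [this]
      refine sum_le_card_nsmul _ _ _ fun x _ => ?_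
      have h1 := hD' x
      have h2 := hbig D' hr x
      have h3 : n x ≤ K * n x := Nat.le_mul_of_pos_left _ (by omega)
      omega
    have hKn : ∀ x ∈ S, K ≤ K * n x := fun x hx =>
      Nat.le_mul_of_pos_right _ (mem_filter.1 hx).2
    have hq0 : 1 ≤ q := by
      by_contra h
      obtain h : q = 0 := by omega
      rw [h] at hq1
      have h1 : 2 ^ 6 * (2 ^ ρ) ^ 4 * 1 ^ 3 * 1 ≤ 2 ^ 6 * (2 ^ ρ) ^ 4 * (2 ^ ℓ) ^ 3 * W := by
        gcongr
      have h2 : 2 * u * (0 + 1) ≤ 2 ^ 6 * (2 ^ ρ) ^ 4 * 1 ^ 3 * 1 := by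
        rw [hudef]
        have : 1 ≤ (2 ^ ρ) ^ 4 := Nat.one_le_pow _ _ hT
        omega
      omega
    have hBS : B.card ≤ 4 * u * (2 ^ ℓ * S.card) := by
      calc B.card ≤ 2 * u * (q + 1) := hq1.le
        _ ≤ 2 * u * (2 * q) := by gcongr; omega
        _ = 4 * u * q := by ring
        _ ≤ _ := Nat.mul_le_mul_left _ hqS
    refine hun (SolvableAt.of_reach' hr
      (F.solvableAt_of_many_const (Y := Z ∪ X) (S := S) ?_ ?_ ?_ ?_ ?_))
    · intro x hx
      rw [mem_union, not_or] at hx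
      have h1 := hD' x
      have h2 := hDZ x hx.1
      simp only [hx.2, if_false] at h1
      omega
    · intro x hx _
      have h1 := hD' x
      have h2 := hKn x hx
      omega
    · intro x hx _
      have h1 := hD' x
      have h2 := hKn x hx
      omega
    · calc (Z ∪ X).card ≤ 2 * K * B.card + u * q := (card_union_le _ _).trans
            (Nat.add_le_add hZB hX)
        _ ≤ 2 * K * B.card + K * B.card := by
            have : u * q ≤ B.card := by nlinarith
            have h2 : B.card ≤ K * B.card := Nat.le_mul_of_pos_left _ (by omega)
            omega
        _ = 3 * K * B.card := by ring
        _ ≤ 3 * K * (4 * u * (2 ^ ℓ * S.card)) := Nat.mul_le_mul_left _ hBS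
        _ = 48 * (2 ^ ρ) ^ 6 * 2 ^ ℓ * S.card := by rw [hKdef, hudef]; ring
        _ ≤ _ := by gcongr; norm_num
    · have h1 := hBlarge.trans_le hBS
      have h2 : 4 * u * 2 ^ ℓ * (2 * (2 ^ ℓ * 2 ^ ℓ) * W) < 4 * u * 2 ^ ℓ * S.card := by
        refine lt_of_le_of_lt ?_ (h1.trans_eq (by ring))
        rw [hudef]
        calc _ = 16 * (2 ^ ρ) ^ 4 * (2 ^ ℓ) ^ 3 * W := by ring
          _ ≤ _ := by gcongr; norm_num
      exact Nat.lt_of_mul_lt_mul_left h2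
  · obtain ⟨p, hpq, ⟨D', n, X, hr, hn, hX, hD'⟩, hstuck⟩ : ∃ p < q, Inv p ∧ ¬ Inv (p + 1) := by
      by_contra hcon
      push Not at hcon
      have : ∀ p ≤ q, Inv p := by
        intro p
        induction p with
        | zero => exact fun _ => h0
        | succ p ih => exact fun hp => hcon p (by omega) (ih (by omega))
      exact hend (this q le_rfl)
    have hXB : 2 * X.card ≤ B.card := by
      calc 2 * X.card ≤ 2 * (u * p) := Nat.mul_le_mul_left _ hX
        _ ≤ 2 * (u * q) := by gcongr
        _ = 2 * u * q := by ring
        _ ≤ _ := hq2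
    set S := B \ X with hSdef
    have hS2 : B.card ≤ 2 * S.card := by
      have : B.card - X.card ≤ S.card := le_card_sdiff X B
      omega
    have hSY : Disjoint S (Z ∪ X) := disjoint_left.2 fun x hx hx' => by
      obtain ⟨h1, h2⟩ := mem_sdiff.1 hx
      rcases mem_union.1 hx' with h | h
      · have := hDB x h1
        have := hZD x h
        omega
      · exact h2 h
    have hD'X : ∀ x ∉ Z ∪ X, K * n x + D x ≤ D' x := by
      intro x hx
      rw [mem_union, not_or] at hx
      have h1 := hD' x
      simpa only [hx.2, if_false] using h1
    have hD'Y : ∀ x ∉ Z ∪ X, 1 ≤ D' x := by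
      intro x hx
      have h1 := hD'X x hx
      rw [mem_union, not_or] at hx
      have h2 := hDZ x hx.1
      omega
    have hSB : ∀ x ∈ S, 2 ≤ D x := fun x hx => hDB x (mem_sdiff.1 hx).1
    have hD'S : ∀ x ∈ S, 2 ≤ D' x := by
      intro x hx
      have h1 := hD'X x (disjoint_left.1 hSY hx)
      have h2 := hSB x hx
      omega
    refine hun (SolvableAt.of_reach' hr
      (F.solvableAt_of_many_two (Y := Z ∪ X) (S := S) hSY hD'Y hD'S ?_ ?_ ?_))
    · intro z hz S'' hS'' hw
      by_contra hcon
      obtain ⟨S', hS', hSc⟩ := exists_subset_card_eq (not_le.1 hcon).le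
      have hS'S : ∀ s ∈ S', s ∈ S := fun s hs => hS'' (hS' hs)
      have hzS : z ∉ S' := fun h => disjoint_left.1 hSY (hS'S z h) hz
      obtain ⟨D'', P₀, hr', hPY, hzP, hSP, hPc, hD''⟩ := exists_reach_collect (G := G) (D := D')
        (Y := Z ∪ X) (S := S') (v := z) (i := ρ) (k := K) hD'Y
        (fun s hs => hD'S s (hS'S s hs)) hzS (fun s hs => hw s (hS' hs))
        (by rw [hSc, hKdef]; exact le_of_eq (by ring))
      -- An obstacle near too many unspent sources would receive one more pile, against the choice
      -- of `p`.
      refine hstuck ⟨D'', n + Pi.single z 1, X ∪ P₀, hr.trans hr', ?_, ?_, ?_⟩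
      · simp [sum_add_distrib, hn]
      · refine (card_union_le _ _).trans ?_
        have : P₀.card ≤ u := by
          rw [hSc] at hPc
          calc P₀.card ≤ 2 * (2 ^ ρ) ^ 3 * 2 ^ ρ := hPc.trans (Nat.mul_le_mul_left _ hρT)
            _ = u := by rw [hudef]; ring
        rw [mul_add, mul_one]
        omega
      · intro x
        have h1 := hD'' x
        by_cases hxP : x ∈ P₀
        · have hxz : x ≠ z := fun h => hzP (h ▸ hxP)
          have hxY : x ∉ Z ∪ X := disjoint_left.1 hPY hxP
          have h2 := hD'X x hxY
          have h3 : 1 + (if x ∈ S' then 1 else 0) ≤ D x := by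
            by_cases hxS : x ∈ S'
            · simpa [hxS] using hSB x (hS'S x hxS)
            · rw [mem_union, not_or] at hxY
              simpa [hxS] using hDZ x hxY.1
          simp only [hxP, hxz, if_true, if_false, mem_union, or_true, Pi.add_apply, ne_eq,
            not_false_eq_true, Pi.single_eq_of_ne, add_zero] at h1 ⊢
          omega
        · have hxS : x ∉ S' := fun h => hxP (hSP h)
          have h2 := hD' x
          simp only [hxP, hxS, if_false, mem_union, or_false, add_zero, Pi.add_apply] at h1 ⊢
          by_cases hxz : x = z
          · subst hxz
            simp only [if_true, Pi.single_eq_same, mul_add, mul_one] at h1 ⊢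
            omega
          · simp only [hxz, if_false, ne_eq, not_false_eq_true, Pi.single_eq_of_ne, add_zero]
              at h1 ⊢
            omega
    · calc (Z ∪ X).card ≤ 2 * K * B.card + X.card := (card_union_le _ _).trans
            (Nat.add_le_add_right hZB _)
        _ ≤ 2 * K * B.card + K * B.card := by
            have h2 : B.card ≤ K * B.card := Nat.le_mul_of_pos_left _ (by omega)
            omega
        _ = 3 * K * B.card := by ring
        _ ≤ 3 * K * (2 * S.card) := Nat.mul_le_mul_left _ hS2
        _ = _ := by rw [hKdef]; ring
    · have h1 := hBlarge.trans_le hS2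
      have h2 : 2 * (2 * (2 ^ ℓ * 2 ^ ℓ) * W) < 2 * S.card := by
        refine lt_of_le_of_lt ?_ h1
        calc _ = 4 * 1 ^ 4 * (2 ^ ℓ) ^ 2 * W := by ring
          _ ≤ _ := by gcongr <;> norm_num
      omega

theorem isClassZero [Nonempty V] : IsClassZero G := by
  classical
  unfold IsClassZero pebblingNumber
  refine le_antisymm (Nat.sInf_le ?_) (le_csInf ⟨Fintype.card V, ?_⟩ ?_)
  pick_goal 3
  · intro k hk
    by_contra hcon
    rw [not_le] at hcon
    obtain ⟨r⟩ := ‹Nonempty V›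
    -- Fewer than `|V|` pebbles, placed singly on vertices other than `r`, allow no step at all.
    obtain ⟨S, hS, hSc⟩ := exists_subset_card_eq (s := univ.erase r) (n := k) (by
      rw [card_erase_of_mem (mem_univ _), card_univ]; omega)
    obtain ⟨E, hE, hEr⟩ := hk (fun x => if x ∈ S then 1 else 0) (by simp [hSc]) r
    rcases Relation.ReflTransGen.cases_head hE with h | ⟨D', ⟨a, b, -, h2, -⟩, -⟩
    · subst h
      have : r ∉ S := fun h => by simpa using hS h
      simp [this] at hEr
    · simp only at h2
      split_ifs at h2 <;> omega
  all_goals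
    intro D hD r
    by_cases hZ : (univ.filter fun x => D x = 0).card ≤ 2 ^ 8 * (2 ^ ρ) ^ 6 * (2 ^ ℓ) ^ 3 * W
    · exact F.solvableAt_of_card_zero_le hD r hZ
    · exact F.solvableAt_of_card_zero_gt hD r (not_le.1 hZ)

end WalkSystem

end ClassZero

end Pebbling

open Finset

/-! ### Symmetry of the Kneser graph, spheres, and walks that exchange elements. -/

namespace Kneser

/-- Permutations act transitively on the pairs of sets with given cardinalities. -/
lemma exists_perm_map_eq {α : Type*} [Fintype α] [DecidableEq α] {x y x' y' : Finset α}
    (hx : x.card = x'.card) (hy : y.card = y'.card) (hxy : (x ∩ y).card = (x' ∩ y').card) :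
    ∃ σ : Equiv.Perm α, x.map σ.toEmbedding = x' ∧ y.map σ.toEmbedding = y' := by
  -- The three cardinalities determine how many elements are of each of the four membership types,
  -- so a bijection that preserves types exists.
  set f : Finset α → Finset α → α → Bool × Bool := fun x y v => (decide (v ∈ x), decide (v ∈ y))
    with hf
  have hcard : ∀ (x y : Finset α), ∀ c : Bool × Bool, Fintype.card {v // f x y v = c} =
      match c with
      | (true, true) => (x ∩ y).card
      | (true, false) => x.card - (x ∩ y).card
      | (false, true) => y.card - (x ∩ y).card
      | (false, false) => Fintype.card α - (x.card + y.card - (x ∩ y).card) := by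
    intro x y c
    rw [Fintype.card_subtype]
    rcases c with ⟨_ | _, _ | _⟩
    · simp only
      rw [← card_union, ← card_compl]
      congr 1; ext v; simp [hf]
    · simp only
      rw [← card_sdiff]
      congr 1; ext v; simp [hf]; tauto
    · simp only
      rw [inter_comm, ← card_sdiff]
      congr 1; ext v; simp [hf]
    · simp only
      congr 1; ext v; simp [hf]
  have hfib : ∀ c, Nonempty ({v // f x y v = c} ≃ {v // f x' y' v = c}) := by
    intro c
    rw [← Fintype.card_eq, hcard, hcard, hx, hy, hxy]
  set σ := Equiv.ofFiberEquiv fun c => (hfib c).some with hσ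
  have h : ∀ v, f x' y' (σ v) = f x y v := Equiv.ofFiberEquiv_map _
  refine ⟨σ, ?_, ?_⟩
  · ext v
    obtain ⟨v, rfl⟩ := σ.surjective v
    have := congrArg Prod.fst (h v)
    simp only [hf, decide_eq_decide] at this
    simp [this]
  · ext v
    obtain ⟨v, rfl⟩ := σ.surjective v
    have := congrArg Prod.snd (h v)
    simp only [hf, decide_eq_decide] at this
    simp [this]

variable {n t s : ℕ}

/-- The action of a permutation on the vertices of a Kneser graph. -/
def act (σ : Equiv.Perm (Fin n)) (A : {A : Finset (Fin n) // A.card = t}) :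
    {A : Finset (Fin n) // A.card = t} :=
  ⟨A.1.map σ.toEmbedding, by rw [card_map]; exact A.2⟩

lemma act_mul (σ τ : Equiv.Perm (Fin n)) (A : {A : Finset (Fin n) // A.card = t}) :
    act (σ * τ) A = act σ (act τ A) := by
  apply Subtype.ext
  simp only [act, map_map]
  congr 1

lemma act_injective (σ : Equiv.Perm (Fin n)) :
    Function.Injective (act σ : {A : Finset (Fin n) // A.card = t} → _) := by
  intro A B h
  have h1 := congrArg Subtype.val h
  exact Subtype.ext (map_injective _ h1)

lemma act_adj {A B : {A : Finset (Fin n) // A.card = t}} (σ : Equiv.Perm (Fin n))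
    (h : (kneserGraph n t).Adj A B) : (kneserGraph n t).Adj (act σ A) (act σ B) :=
  ⟨fun h' => h.1 (act_injective σ h'), (disjoint_map _).2 h.2⟩

lemma card_inter_act (σ : Equiv.Perm (Fin n)) (A B : {A : Finset (Fin n) // A.card = t}) :
    ((act σ A).1 ∩ (act σ B).1).card = (A.1 ∩ B.1).card := by
  simp only [act]
  rw [← map_inter, card_map]

lemma exists_act_eq {A B A' B' : {A : Finset (Fin n) // A.card = t}}
    (h : (A.1 ∩ B.1).card = (A'.1 ∩ B'.1).card) : ∃ σ, act σ A = A' ∧ act σ B = B' := by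
  obtain ⟨σ, h1, h2⟩ := exists_perm_map_eq (A.2.trans A'.2.symm) (B.2.trans B'.2.symm) h
  exact ⟨σ, Subtype.ext h1, Subtype.ext h2⟩

/-- The vertices that share exactly `b` elements with `A`. -/
def sphere (A : {A : Finset (Fin n) // A.card = t}) (b : ℕ) :
    Finset {A : Finset (Fin n) // A.card = t} :=
  univ.filter fun B => (A.1 ∩ B.1).card = b

/-- By transitivity all target vertices `B` are hit by the same number of permutations. -/
lemma card_act_eq (A B : {A : Finset (Fin n) // A.card = t}) :
    (univ.filter fun σ => act σ A = B).card = n.factorial / n.choose t := by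
  have hconst : ∀ C, (univ.filter fun σ => act σ A = C).card =
      (univ.filter fun σ => act σ A = B).card := by
    intro C
    obtain ⟨τ, hτ, -⟩ := exists_act_eq (A := C) (B := C) (A' := B) (B' := B) (by
      simp [C.2, B.2])
    refine card_bij (fun σ _ => τ * σ) ?_ ?_ ?_
    · intro σ hσ
      simp only [mem_filter, mem_univ, true_and] at hσ ⊢
      rw [act_mul, hσ, hτ]
    · intro σ _ σ' _ h
      exact mul_left_cancel h
    · intro σ hσ
      refine ⟨τ⁻¹ * σ, ?_, by simp⟩
      simp only [mem_filter, mem_univ, true_and] at hσ ⊢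
      apply act_injective τ
      rw [← act_mul, hτ, mul_inv_cancel_left, hσ]
  have hsum : n.choose t * (univ.filter fun σ => act σ A = B).card = n.factorial := by
    have h1 := card_eq_sum_card_fiberwise (s := (univ : Finset (Equiv.Perm (Fin n))))
      (t := univ) (f := fun σ => act σ A) (fun _ _ => mem_univ _)
    rw [sum_congr rfl fun C _ => hconst C, sum_const, card_univ, card_univ,
      Fintype.card_perm, Fintype.card_fin, smul_eq_mul, Fintype.card_finset_len,
      Fintype.card_fin] at h1
    exact h1.symm
  have hpos : 0 < n.choose t := by
    by_contra h
    rw [Nat.eq_zero_of_not_pos h, zero_mul] at hsum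
    exact n.factorial_ne_zero hsum.symm
  exact (Nat.div_eq_of_eq_mul_right hpos hsum.symm).symm

/-- Given that `X` goes to `A`, the image of `Y` is uniform on a sphere around `A`. Sphere sizes
thus control the spread of the translated walks. -/
lemma card_act_pair_mul {X Y A B : {A : Finset (Fin n) // A.card = t}}
    (h : (X.1 ∩ Y.1).card = (A.1 ∩ B.1).card) :
    (univ.filter fun σ => act σ X = A ∧ act σ Y = B).card *
      (sphere A (X.1 ∩ Y.1).card).card = n.factorial / n.choose t := by
  have hconst : ∀ C ∈ sphere A (X.1 ∩ Y.1).card,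
      (univ.filter fun σ => act σ X = A ∧ act σ Y = C).card =
      (univ.filter fun σ => act σ X = A ∧ act σ Y = B).card := by
    intro C hC
    have hC' : (A.1 ∩ C.1).card = (A.1 ∩ B.1).card := (mem_filter.1 hC).2.trans h
    obtain ⟨τ, hτ, hτ'⟩ := exists_act_eq hC'
    refine card_bij (fun σ _ => τ * σ) ?_ ?_ ?_
    · intro σ hσ
      simp only [mem_filter, mem_univ, true_and] at hσ ⊢
      rw [act_mul, act_mul, hσ.1, hσ.2, hτ, hτ']
      exact ⟨rfl, rfl⟩
    · intro σ _ σ' _ h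
      exact mul_left_cancel h
    · intro σ hσ
      refine ⟨τ⁻¹ * σ, ?_, by simp⟩
      simp only [mem_filter, mem_univ, true_and] at hσ ⊢
      constructor
      · apply act_injective τ
        rw [← act_mul, hτ, mul_inv_cancel_left, hσ.1]
      · apply act_injective τ
        rw [← act_mul, hτ', mul_inv_cancel_left, hσ.2]
  have hsum := card_eq_sum_card_fiberwise (s := univ.filter fun σ => act σ X = A)
    (t := sphere A (X.1 ∩ Y.1).card) (f := fun σ => act σ Y) (by
      intro σ hσ
      have hσ' : act σ X = A := (mem_filter.1 hσ).2
      refine mem_filter.2 ⟨mem_univ _, ?_⟩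
      rw [← hσ', card_inter_act])
  simp only [filter_filter] at hsum
  rw [← card_act_eq X A, hsum, sum_congr rfl hconst, sum_const, smul_eq_mul, mul_comm]

lemma card_act_pair_mul_le (X Y A B : {A : Finset (Fin n) // A.card = t}) {c : ℕ}
    (hc : c ≤ (sphere A (X.1 ∩ Y.1).card).card) :
    (univ.filter fun σ => act σ X = A ∧ act σ Y = B).card * c ≤ n.factorial / n.choose t := by
  by_cases h : (X.1 ∩ Y.1).card = (A.1 ∩ B.1).card
  · rw [← card_act_pair_mul h]
    exact Nat.mul_le_mul_left _ hc
  · rw [filter_false_of_mem]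
    · simp
    · rintro σ - ⟨rfl, rfl⟩
      exact h (card_inter_act σ X Y).symm

lemma choose_mul_choose_le_card_sphere (A : {A : Finset (Fin n) // A.card = t}) {b : ℕ}
    (hb : b ≤ t) : t.choose b * (n - t).choose (t - b) ≤ (sphere A b).card := by
  have h1 : t.choose b * (n - t).choose (t - b) =
      (powersetCard b A.1 ×ˢ powersetCard (t - b) A.1ᶜ).card := by
    rw [card_product, card_powersetCard, card_powersetCard, A.2, card_compl, A.2, Fintype.card_fin]
  rw [h1, ← card_map (Function.Embedding.subtype fun A : Finset (Fin n) => A.card = t)]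
  have hsplit : ∀ p ∈ powersetCard b A.1 ×ˢ powersetCard (t - b) A.1ᶜ,
      A.1 ∩ (p.1 ∪ p.2) = p.1 ∧ A.1ᶜ ∩ (p.1 ∪ p.2) = p.2 := by
    rintro ⟨p, r⟩ hpr
    simp only [mem_product, mem_powersetCard] at hpr
    obtain ⟨⟨hp, -⟩, hr, -⟩ := hpr
    constructor
    · ext v
      have h1 := @hp v
      have h2 := @hr v
      simp only [mem_inter, mem_union, mem_compl] at *
      tauto
    · ext v
      have h1 := @hp v
      have h2 := @hr v
      simp only [mem_inter, mem_union, mem_compl] at *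
      tauto
  refine card_le_card_of_injOn (fun p => p.1 ∪ p.2) ?_ ?_
  · intro p hp
    have hs := hsplit p hp
    have hp' := mem_product.1 hp
    rw [mem_powersetCard, mem_powersetCard] at hp'
    simp only [coe_map, Set.mem_image, mem_coe]
    refine ⟨⟨p.1 ∪ p.2, ?_⟩, ?_, rfl⟩
    · rw [card_union_of_disjoint, hp'.1.2, hp'.2.2]
      · omega
      · exact disjoint_left.2 fun v h1 h2 => mem_compl.1 (hp'.2.1 h2) (hp'.1.1 h1)
    · simp only [sphere, mem_filter, mem_univ, true_and]
      rw [hs.1, hp'.1.2]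
  · intro p hp p' hp' h
    have h : p.1 ∪ p.2 = p'.1 ∪ p'.2 := h
    have hs := hsplit p hp
    have hs' := hsplit p' hp'
    rw [h] at hs
    exact Prod.ext (hs.1.symm.trans hs'.1) (hs.2.symm.trans hs'.2)

/-- In two steps the walk exchanges up to `s` further elements. -/
lemma exists_two_steps (ht : 1 ≤ t) (X Z : {A : Finset (Fin (2 * t + s)) // A.card = t})
    {a δ : ℕ} (hZ : (X.1 ∩ Z.1).card = t - a) (ha : a + δ ≤ t) (hδ : δ ≤ s) :
    ∃ Y Z', (kneserGraph (2 * t + s) t).Adj Z Y ∧ (kneserGraph (2 * t + s) t).Adj Y Z' ∧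
      (X.1 ∩ Y.1).card = a ∧ (X.1 ∩ Z'.1).card = t - (a + δ) := by
  obtain ⟨R, hR, hRc⟩ := exists_subset_card_eq (s := X.1 ∩ Z.1) (n := δ) (by omega)
  have hXZ : (X.1 ∪ Z.1).card = t + a := by
    have := card_union_add_card_inter X.1 Z.1
    rw [X.2, Z.2] at this
    omega
  obtain ⟨I, hI, hIc⟩ := exists_subset_card_eq (s := (X.1 ∪ Z.1)ᶜ) (n := δ) (by
    rw [card_compl, hXZ, Fintype.card_fin]; omega)
  have hIX : Disjoint I (X.1 ∪ Z.1) :=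
    disjoint_left.2 fun v hv hv' => mem_compl.1 (hI hv) hv'
  -- The walk exchanges `R` for `I`, passing through `(X \ Z) ∪ J`. Outside `X ∪ Z ∪ I` there are `t
  -- - a + s - δ` elements, which leaves room for `J` because `δ ≤ s`.
  obtain ⟨J, hJ, hJc⟩ := exists_subset_card_eq (s := (X.1 ∪ Z.1 ∪ I)ᶜ) (n := t - a) (by
    rw [card_compl, card_union_of_disjoint hIX.symm, hXZ, hIc, Fintype.card_fin]; omega)
  have hJm : ∀ v ∈ J, v ∉ X.1 ∧ v ∉ Z.1 ∧ v ∉ I := by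
    intro v hv
    have := mem_compl.1 (hJ hv)
    simp only [mem_union, not_or] at this
    exact ⟨this.1.1, this.1.2, this.2⟩
  have hIm : ∀ v ∈ I, v ∉ X.1 ∧ v ∉ Z.1 := by
    intro v hv
    have := mem_compl.1 (hI hv)
    simpa only [mem_union, not_or] using this
  have hRm : ∀ v ∈ R, v ∈ X.1 ∧ v ∈ Z.1 := fun v hv => mem_inter.1 (hR hv)
  have hXdZ : (X.1 \ Z.1).card = a := by
    rw [card_sdiff, inter_comm, X.2, hZ]; omega
  have hY : ((X.1 \ Z.1) ∪ J).card = t := by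
    rw [card_union_of_disjoint, hXdZ, hJc]
    · omega
    · exact disjoint_left.2 fun v h1 h2 => (hJm v h2).1 (mem_sdiff.1 h1).1
  have hZ' : ((Z.1 \ R) ∪ I).card = t := by
    rw [card_union_of_disjoint, card_sdiff_of_subset (fun v hv => (hRm v hv).2), Z.2, hRc, hIc]
    · omega
    · exact disjoint_left.2 fun v h1 h2 => (hIm v h2).2 (mem_sdiff.1 h1).1
  have hadj : ∀ P Q : {A : Finset (Fin (2 * t + s)) // A.card = t}, Disjoint P.1 Q.1 →
      (kneserGraph (2 * t + s) t).Adj P Q := by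
    intro P Q h
    refine ⟨?_, h⟩
    rintro rfl
    rw [disjoint_self_iff_empty] at h
    have := P.2
    rw [h, card_empty] at this
    omega
  refine ⟨⟨_, hY⟩, ⟨_, hZ'⟩, hadj _ _ ?_, hadj _ _ ?_, ?_, ?_⟩
  · refine disjoint_left.2 fun v h1 h2 => ?_
    rcases mem_union.1 h2 with h | h
    · exact (mem_sdiff.1 h).2 h1
    · exact (hJm v h).2.1 h1
  · refine disjoint_left.2 fun v h1 h2 => ?_
    rcases mem_union.1 h1 with h | h <;> rcases mem_union.1 h2 with h' | h'
    · exact (mem_sdiff.1 h).2 (mem_sdiff.1 h').1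
    · exact (hIm v h').1 (mem_sdiff.1 h).1
    · exact (hJm v h).2.1 (mem_sdiff.1 h').1
    · exact (hJm v h).2.2 h'
  · rw [← hXdZ]
    congr 1
    ext v
    have h1 := hJm v
    simp only [mem_inter, mem_union, mem_sdiff]
    tauto
  · have : X.1 ∩ ((Z.1 \ R) ∪ I) = (X.1 ∩ Z.1) \ R := by
      ext v
      have h1 := hIm v
      simp only [mem_inter, mem_union, mem_sdiff]
      tauto
    simp only
    rw [this, card_sdiff_of_subset hR, hZ, hRc]
    omega

/-- A walk from `X` that exchanges `q` elements in every two steps until `e` elements are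
exchanged. -/
lemma exists_walk (ht : 1 ≤ t) (X : {A : Finset (Fin (2 * t + s)) // A.card = t})
    {q e : ℕ} (hq : q ≤ s) (he : e ≤ t) :
    ∃ p : ℕ → {A : Finset (Fin (2 * t + s)) // A.card = t}, p 0 = X ∧
      (∀ i, (kneserGraph (2 * t + s) t).Adj (p i) (p (i + 1))) ∧
      (∀ i, (X.1 ∩ (p (2 * i)).1).card = t - min (i * q) e) ∧
      ∀ i, (X.1 ∩ (p (2 * i + 1)).1).card = min (i * q) e := by
  have hstep : ∀ i, ∀ Z : {A : Finset (Fin (2 * t + s)) // A.card = t},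
      (X.1 ∩ Z.1).card = t - min (i * q) e →
      ∃ Y Z', (kneserGraph (2 * t + s) t).Adj Z Y ∧ (kneserGraph (2 * t + s) t).Adj Y Z' ∧
      (X.1 ∩ Y.1).card = min (i * q) e ∧ (X.1 ∩ Z'.1).card = t - min ((i + 1) * q) e := by
    intro i Z hZ
    have h1 : (i + 1) * q = i * q + q := by ring
    have := exists_two_steps ht X Z (a := min (i * q) e)
      (δ := min ((i + 1) * q) e - min (i * q) e) hZ (by omega) (by omega)
    rwa [show min (i * q) e + (min ((i + 1) * q) e - min (i * q) e) = min ((i + 1) * q) e by omega]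
      at this
  choose! Y Z' h1 h2 h3 h4 using hstep
  let z : ℕ → {A : Finset (Fin (2 * t + s)) // A.card = t} := fun i => Nat.rec X Z' i
  have hz : ∀ i, (X.1 ∩ (z i).1).card = t - min (i * q) e := by
    intro i
    induction i with
    | zero => simp [z, X.2]
    | succ i ih => exact h4 i (z i) ih
  refine ⟨fun j => if j % 2 = 0 then z (j / 2) else Y (j / 2) (z (j / 2)), rfl, ?_, ?_, ?_⟩
  · intro j
    rcases Nat.even_or_odd' j with ⟨i, rfl | rfl⟩
    · have e1 : (2 * i) % 2 = 0 := by omega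
      have e2 : (2 * i + 1) % 2 ≠ 0 := by omega
      have e3 : 2 * i / 2 = i := by omega
      have e4 : (2 * i + 1) / 2 = i := by omega
      simp only [e1, e2, e3, e4, if_true, if_false]
      exact h1 i (z i) (hz i)
    · have e1 : (2 * i + 1 + 1) % 2 = 0 := by omega
      have e2 : (2 * i + 1) % 2 ≠ 0 := by omega
      have e3 : (2 * i + 1 + 1) / 2 = i + 1 := by omega
      have e4 : (2 * i + 1) / 2 = i := by omega
      simp only [e1, e2, e3, e4, if_true, if_false]
      exact h2 i (z i) (hz i)
  · intro i
    have e1 : (2 * i) % 2 = 0 := by omega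
    have e3 : 2 * i / 2 = i := by omega
    simp only [e1, e3, if_true]
    exact hz i
  · intro i
    have e2 : (2 * i + 1) % 2 ≠ 0 := by omega
    have e4 : (2 * i + 1) / 2 = i := by omega
    simp only [e2, e4, if_false]
    exact h3 i (z i) (hz i)

end Kneser

open Finset

/-! ### The walk system of translates, and the criterion in terms of sphere sizes. -/

namespace Kneser

variable {t s q e h ρ k₀ A : ℕ}

lemma card_vertices (n t : ℕ) :
    Fintype.card {A : Finset (Fin n) // A.card = t} = n.choose t := by
  rw [Fintype.card_finset_len, Fintype.card_fin]

lemma factorial_div_choose_pos {n t : ℕ} (X : {A : Finset (Fin n) // A.card = t}) :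
    0 < n.factorial / n.choose t := by
  rw [← card_act_eq X X, card_pos]
  refine ⟨1, mem_filter.2 ⟨mem_univ _, Subtype.ext map_refl⟩⟩

/-- Large sets of vertices are connected by a short walk avoiding a given small set. -/
lemma exists_walk_avoiding (ht : 1 ≤ t) (hq : q ≤ s) (hqh : t ≤ h * q)
    (A₁ A₂ Z : Finset {A : Finset (Fin (2 * t + s)) // A.card = t})
    (hlt : (t + 1) * (2 * h + 1) * Z.card *
      Fintype.card {A : Finset (Fin (2 * t + s)) // A.card = t} < A₁.card * A₂.card) :
    ∃ x : ℕ → {A : Finset (Fin (2 * t + s)) // A.card = t}, x 0 ∈ A₁ ∧ x (2 * h) ∈ A₂ ∧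
      (∀ i < 2 * h, (kneserGraph (2 * t + s) t).Adj (x i) (x (i + 1))) ∧
      ∀ i ≤ 2 * h, x i ∉ Z := by
  obtain ⟨X, -⟩ : A₁.Nonempty := by
    rw [← card_pos]
    by_contra hcon
    rw [Nat.eq_zero_of_not_pos hcon] at hlt
    omega
  set N := Fintype.card {A : Finset (Fin (2 * t + s)) // A.card = t} with hN
  set m := (2 * t + s).factorial / (2 * t + s).choose t with hm
  have hmpos : 0 < m := factorial_div_choose_pos X
  have : Nonempty {A : Finset (Fin (2 * t + s)) // A.card = t} := ⟨X⟩
  have hp := fun a (ha : a ≤ t) => exists_walk ht X hq ha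
  choose! p hp0 hpadj hpe hpo using hp
  by_contra hcon
  push Not at hcon
  set Γ : ℕ → Finset (Equiv.Perm (Fin (2 * t + s))) := fun a =>
    univ.filter fun σ => act σ X ∈ A₁ ∧ act σ (p a (2 * h)) ∈ A₂ with hΓ
  have hΓle : ∀ a ≤ t, (Γ a).card ≤ (2 * h + 1) * (Z.card * m) := by
    intro a ha
    have hsub : Γ a ⊆ (range (2 * h + 1)).biUnion fun i => Z.biUnion fun z =>
        univ.filter fun σ => act σ (p a i) = z := by
      intro σ hσ
      obtain ⟨-, h1, h2⟩ := mem_filter.1 hσ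
      obtain ⟨i, hi, hz⟩ := hcon (fun i => act σ (p a i)) (by simpa [hp0 a ha] using h1) h2
        fun i _ => act_adj σ (hpadj a ha i)
      simp only [mem_biUnion, mem_range, mem_filter, mem_univ, true_and]
      exact ⟨i, by omega, _, hz, rfl⟩
    refine (card_le_card hsub).trans ((card_biUnion_le_card_mul _ _ (Z.card * m) ?_).trans_eq
      (by simp))
    intro i _
    exact card_biUnion_le_card_mul _ _ _ fun z _ => (card_act_eq _ z).le
  -- The walk exchanging `a = t - |u ∩ u'|` elements has translates from `u` to `u'`, and these are
  -- at least a fraction `1 / N` of those starting at `u`. The sum over `a` makes the bound uniform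
  -- in the pair.
  have hpair : ∀ w ∈ A₁ ×ˢ A₂, m ≤ N * ∑ a ∈ range (t + 1),
      (univ.filter fun σ => act σ X = w.1 ∧ act σ (p a (2 * h)) = w.2).card := by
    rintro ⟨u, u'⟩ -
    have hle : (u.1 ∩ u'.1).card ≤ t := (card_le_card inter_subset_left).trans_eq u.2
    set a := t - (u.1 ∩ u'.1).card with ha
    have hat : a ≤ t := by omega
    have hcard : (X.1 ∩ (p a (2 * h)).1).card = (u.1 ∩ u'.1).card := by
      rw [hpe a hat]; omega
    have h1 := card_act_pair_mul hcard
    have h2 : (sphere u (X.1 ∩ (p a (2 * h)).1).card).card ≤ N := card_le_univ _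
    calc m ≤ (univ.filter fun σ => act σ X = u ∧ act σ (p a (2 * h)) = u').card * N := by
          rw [hm, ← h1]; exact Nat.mul_le_mul_left _ h2
      _ = N * (univ.filter fun σ => act σ X = u ∧ act σ (p a (2 * h)) = u').card := mul_comm _ _
      _ ≤ _ := by
          refine Nat.mul_le_mul_left _ ?_
          exact single_le_sum (f := fun a => (univ.filter fun σ =>
            act σ X = u ∧ act σ (p a (2 * h)) = u').card) (fun _ _ => Nat.zero_le _)
            (mem_range.2 (by omega))
  have hfib : ∀ a, ∑ w ∈ A₁ ×ˢ A₂,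
      (univ.filter fun σ => act σ X = w.1 ∧ act σ (p a (2 * h)) = w.2).card = (Γ a).card := by
    intro a
    rw [card_eq_sum_card_fiberwise (s := Γ a) (t := A₁ ×ˢ A₂)
      (f := fun σ => (act σ X, act σ (p a (2 * h))))]
    · refine sum_congr rfl fun w hw => ?_
      obtain ⟨h1, h2⟩ := mem_product.1 hw
      congr 1
      ext σ
      simp only [hΓ, mem_filter, mem_univ, true_and, Prod.ext_iff]
      constructor
      · rintro ⟨h3, h4⟩
        exact ⟨⟨h3 ▸ h1, h4 ▸ h2⟩, h3, h4⟩
      · exact fun h => h.2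
    · intro σ hσ
      obtain ⟨-, h1, h2⟩ := mem_filter.1 hσ
      exact mem_product.2 ⟨h1, h2⟩
  have hfinal : A₁.card * A₂.card * m ≤ (t + 1) * (2 * h + 1) * Z.card * N * m := by
    calc A₁.card * A₂.card * m = ∑ w ∈ A₁ ×ˢ A₂, m := by simp [card_product]
      _ ≤ ∑ w ∈ A₁ ×ˢ A₂, N * ∑ a ∈ range (t + 1),
          (univ.filter fun σ => act σ X = w.1 ∧ act σ (p a (2 * h)) = w.2).card :=
          sum_le_sum hpair
      _ = N * ∑ a ∈ range (t + 1), (Γ a).card := by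
          rw [← mul_sum, sum_comm]
          simp only [hfib]
      _ ≤ N * ∑ a ∈ range (t + 1), (2 * h + 1) * (Z.card * m) :=
          Nat.mul_le_mul_left _ (sum_le_sum fun a ha => hΓle a (by
            have := mem_range.1 ha; omega))
      _ = _ := by rw [sum_const, card_range, smul_eq_mul]; ring
  have := Nat.le_of_mul_le_mul_right hfinal hmpos
  omega

/-- The Kneser graph is Class 0 if the spheres that a walk away from a vertex passes through are
large. -/
theorem isClassZero_of_spheres (ht : 1 ≤ t) (hq : q ≤ s) (hqh : t ≤ h * q) (he : e ≤ t)
    (hN : (2 * t + s).choose t ≤ (t + 1) * (t.choose e * (t + s).choose e))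
    (hρ : 1 ≤ ρ) (hρh : ρ ≤ 2 * h)
    (hk : 2 ^ 8 * (2 ^ ρ) ^ 6 * (2 * h + 1) ^ 2 ≤ k₀)
    (hA : 2 ^ 14 * (2 ^ ρ) ^ 8 * (2 ^ (2 * h)) ^ 6 * (t + 1) ^ 4 ≤ A)
    (hke : ∀ i, 1 ≤ i → k₀ ≤ t.choose (min (i * q) e) * (t + s).choose (min (i * q) e))
    (hko : ∀ i < h, k₀ ≤ t.choose (min (i * q) e) * (t + s).choose (t - min (i * q) e))
    (hAe : ∀ i, ρ ≤ 2 * i → A ≤ t.choose (min (i * q) e) * (t + s).choose (min (i * q) e))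
    (hAo : ∀ i < h, ρ ≤ 2 * i + 1 →
      A ≤ t.choose (min (i * q) e) * (t + s).choose (t - min (i * q) e)) :
    Pebbling.IsClassZero (kneserGraph (2 * t + s) t) := by
  classical
  obtain ⟨X₀, -, hX₀⟩ := exists_subset_card_eq (s := (univ : Finset (Fin (2 * t + s)))) (n := t)
    (by rw [card_univ, Fintype.card_fin]; omega)
  set X : {A : Finset (Fin (2 * t + s)) // A.card = t} := ⟨X₀, hX₀⟩
  have : Nonempty {A : Finset (Fin (2 * t + s)) // A.card = t} := ⟨X⟩
  obtain ⟨p, hp0, hpadj, hpe, hpo⟩ := exists_walk ht X hq he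
  have hnt : 2 * t + s - t = t + s := by omega
  have hsphe : ∀ i (S : {A : Finset (Fin (2 * t + s)) // A.card = t}),
      t.choose (min (i * q) e) * (t + s).choose (min (i * q) e) ≤
        (sphere S (X.1 ∩ (p (2 * i)).1).card).card := by
    intro i S
    rw [hpe]
    have := choose_mul_choose_le_card_sphere S (b := t - min (i * q) e) (by omega)
    rwa [hnt, Nat.choose_symm (by omega), show t - (t - min (i * q) e) = min (i * q) e by omega]
      at this
  have hspho : ∀ i (S : {A : Finset (Fin (2 * t + s)) // A.card = t}),
      t.choose (min (i * q) e) * (t + s).choose (t - min (i * q) e) ≤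
        (sphere S (X.1 ∩ (p (2 * i + 1)).1).card).card := by
    intro i S
    rw [hpo]
    have := choose_mul_choose_le_card_sphere S (b := min (i * q) e) (by omega)
    rwa [hnt] at this
  have F : Pebbling.WalkSystem (kneserGraph (2 * t + s) t) (Equiv.Perm (Fin (2 * t + s)))
      (2 * h) ρ k₀ A (t + 1) ((2 * t + s).factorial / (2 * t + s).choose t) :=
    { walk := fun σ j => act σ (p j)
      adj := fun σ i _ => act_adj σ (hpadj i)
      card_eq := fun j _ v => by convert card_act_eq (p j) v
      spread_first := by
        intro j hj hjh S S'
        rw [hp0]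
        refine (le_of_eq (by congr!)).trans (card_act_pair_mul_le X (p j) S S' (c := k₀) ?_)
        rcases Nat.even_or_odd' j with ⟨i, rfl | rfl⟩
        · exact (hke i (by omega)).trans (hsphe i S)
        · exact (hko i (by omega)).trans (hspho i S)
      spread := by
        intro j hj hjh S S'
        rw [hp0]
        refine (le_of_eq (by congr!)).trans (card_act_pair_mul_le X (p j) S S' (c := A) ?_)
        rcases Nat.even_or_odd' j with ⟨i, rfl | rfl⟩
        · exact (hAe i hj).trans (hsphe i S)
        · exact (hAo i (by omega) hj).trans (hspho i S)
      spread_last := by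
        intro S S'
        rw [hp0, card_vertices]
        have h1 := card_act_pair_mul_le X (p (2 * h)) S S' (hsphe h S)
        rw [show min (h * q) e = e by omega] at h1
        calc _ ≤ (univ.filter fun σ => act σ X = S ∧ act σ (p (2 * h)) = S').card *
              ((t + 1) * (t.choose e * (t + s).choose e)) :=
              Nat.mul_le_mul (le_of_eq (by congr!)) hN
          _ = (t + 1) * ((univ.filter fun σ => act σ X = S ∧ act σ (p (2 * h)) = S').card *
              (t.choose e * (t + s).choose e)) := by ring
          _ ≤ _ := Nat.mul_le_mul_left _ h1
      connect := fun A₁ A₂ Z hlt => exists_walk_avoiding ht hq hqh A₁ A₂ Z hlt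
      m_pos := factorial_div_choose_pos X
      one_le_rho := hρ
      rho_le := hρh
      k₀_ge := hk
      A_ge := hA }
  exact F.isClassZero

end Kneser

open Finset

/-! ### Binomial estimates and choice of parameters. -/

namespace Kneser

variable {t s : ℕ}

/-- A modal value of the size of the intersection of two random vertices. -/
lemma exists_mode (t s : ℕ) : ∃ e ≤ t,
    (∀ a ≤ t, t.choose a * (t + s).choose a ≤ t.choose e * (t + s).choose e) ∧
    (2 * t + s).choose t ≤ (t + 1) * (t.choose e * (t + s).choose e) := by
  obtain ⟨e, he, hmax⟩ := exists_max_image (range (t + 1))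
    (fun a => t.choose a * (t + s).choose a) ⟨0, by simp⟩
  refine ⟨e, by have := mem_range.1 he; omega,
    fun a ha => hmax a (mem_range.2 (by omega)), ?_⟩
  -- Vandermonde's identity has `t + 1` terms, each at most the largest.
  rw [show 2 * t + s = t + s + t by ring, Nat.add_choose_eq,
    Finset.Nat.sum_antidiagonal_eq_sum_range_succ fun i j => (t + s).choose i * t.choose j]
  refine (sum_le_card_nsmul _ _ (t.choose e * (t + s).choose e) fun a ha => ?_).trans
    (by simp)
  have hat : a ≤ t := by have := mem_range.1 ha; omega
  rw [Nat.choose_symm hat, mul_comm]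
  exact hmax a ha

/-- The ratio of consecutive terms, used to locate the mode. -/
lemma choose_mul_choose_succ (t s a : ℕ) :
    t.choose (a + 1) * (t + s).choose (a + 1) * (a + 1) ^ 2 =
      t.choose a * (t + s).choose a * ((t - a) * (t + s - a)) := by
  have h1 := Nat.choose_succ_right_eq t a
  have h2 := Nat.choose_succ_right_eq (t + s) a
  calc _ = (t.choose (a + 1) * (a + 1)) * ((t + s).choose (a + 1) * (a + 1)) := by ring
    _ = _ := by rw [h1, h2]; ring

/-- The mode lies between `(t - 1) / 2` and `2 (t + 1) / 3` if `s ≤ t`. -/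
lemma mode_bounds {e : ℕ} (he : e ≤ t) (hst : s ≤ t)
    (hmax : ∀ a ≤ t, t.choose a * (t + s).choose a ≤ t.choose e * (t + s).choose e) :
    t ≤ 2 * e + 1 ∧ 3 * e ≤ 2 * t + 2 := by
  constructor
  · by_contra hcon
    have h1 := hmax (e + 1) (by omega)
    have h2 := choose_mul_choose_succ t s e
    have hpos : 0 < t.choose e * (t + s).choose e :=
      Nat.mul_pos (Nat.choose_pos he) (Nat.choose_pos (by omega))
    have h3 : (t - e) * (t + s - e) ≤ (e + 1) ^ 2 := by
      refine Nat.le_of_mul_le_mul_left ?_ hpos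
      rw [← h2]
      exact Nat.mul_le_mul_right _ h1
    have h4 : (e + 2) * (e + 2) ≤ (t - e) * (t + s - e) :=
      Nat.mul_le_mul (by omega) (by omega)
    nlinarith
  · by_contra hcon
    obtain ⟨f, rfl⟩ : ∃ f, e = f + 1 := ⟨e - 1, by omega⟩
    have h1 := hmax f (by omega)
    have h2 := choose_mul_choose_succ t s f
    have hpos : 0 < t.choose f * (t + s).choose f :=
      Nat.mul_pos (Nat.choose_pos (by omega)) (Nat.choose_pos (by omega))
    have h3 : (f + 1) ^ 2 ≤ (t - f) * (t + s - f) := by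
      refine Nat.le_of_mul_le_mul_left ?_ hpos
      rw [← h2]
      exact Nat.mul_le_mul_right _ h1
    have h4 : (3 * (t - f)) * (3 * (t + s - f)) ≤ t * (4 * t) :=
      Nat.mul_le_mul (by omega) (by omega)
    have h5 : 2 * t + 3 ≤ 3 * (f + 1) := by omega
    nlinarith

/-- Binomial coefficients grow towards the middle. -/
lemma choose_le_choose_of_add_le {a b : ℕ} (hba : b ≤ a) (hab : a + b ≤ t) :
    t.choose b ≤ t.choose a := by
  have h1 : t.choose a * a.choose b = t.choose b * (t - b).choose (a - b) := Nat.choose_mul hba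
  have h2 : a.choose b ≤ (t - b).choose (a - b) := by
    rw [← Nat.choose_symm hba]
    exact Nat.choose_le_choose _ (by omega)
  refine Nat.le_of_mul_le_mul_right ?_ (Nat.choose_pos hba)
  rw [h1]
  exact Nat.mul_le_mul_left _ h2

lemma pow_le_choose {b μ : ℕ} (hb : 1 ≤ b) (h : 2 ^ μ * b + b ≤ t + 1) :
    2 ^ (μ * b) ≤ t.choose b := by
  have h1 := Nat.pow_sub_le_descFactorial t b
  rw [Nat.descFactorial_eq_factorial_mul_choose] at h1
  have h2 : (2 ^ μ * b) ^ b ≤ b ^ b * t.choose b :=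
    calc (2 ^ μ * b) ^ b ≤ (t + 1 - b) ^ b := Nat.pow_le_pow_left (by omega) _
      _ ≤ _ := h1.trans (Nat.mul_le_mul_right _ (Nat.factorial_le_pow b))
  rw [mul_pow, ← pow_mul, mul_comm] at h2
  exact Nat.le_of_mul_le_mul_left h2 (Nat.pow_pos hb)

/-- The case of large `s`. -/
lemma isClassZero_of_le {ν : ℕ} (hν : 10 ≤ ν) (htν : 4 ^ ν ≤ t) (htν' : t < 4 ^ (ν + 1))
    (hts : t ≤ s) : Pebbling.IsClassZero (kneserGraph (2 * t + s) t) := by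
  have ht : 1 ≤ t := le_trans (Nat.one_le_pow _ _ (by norm_num)) htν
  obtain ⟨e, he, hmax, hN⟩ := exists_mode t s
  have hcent : (2 * t).choose t ≤ (2 * t + s).choose t := Nat.choose_le_choose _ (by omega)
  set A := (2 * t).choose t / (t + 1) with hAdef
  have hA1 : A ≤ t.choose e * (t + s).choose e := by
    have := Nat.div_le_of_le_mul (hcent.trans hN)
    exact this
  have hA2 : A ≤ (t + s).choose t :=
    (Nat.div_le_self _ _).trans (Nat.choose_le_choose _ (by omega))
  -- The requirement on `A` for `ρ = 1` and `ℓ = 2`, as `34 = 14 + 8 + 2 * 6`: two steps already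
  -- exchange all `e` elements.
  have hA : 2 ^ 34 * (t + 1) ^ 4 ≤ A := by
    rw [hAdef, Nat.le_div_iff_mul_le (by omega)]
    have h1 := Nat.four_pow_le_two_mul_self_mul_centralBinom t ht
    rw [Nat.centralBinom] at h1
    have h2 : 2 ^ 35 * (t + 1) ^ 6 ≤ 4 ^ t := by
      have h3 : t + 1 ≤ 2 ^ (2 * ν + 2) := by
        rw [show 2 * ν + 2 = 2 * (ν + 1) by ring, pow_mul]; exact htν'
      calc 2 ^ 35 * (t + 1) ^ 6 ≤ 2 ^ 35 * (2 ^ (2 * ν + 2)) ^ 6 := by gcongr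
        _ = 2 ^ (12 * ν + 47) := by rw [← pow_mul, ← pow_add]; ring_nf
        _ ≤ 2 ^ (2 * t) := by
            apply Nat.pow_le_pow_right (by norm_num)
            have h4 : ν < 2 ^ ν := Nat.lt_two_pow_self
            have h5 : (4 : ℕ) ^ ν = 2 ^ ν * 2 ^ ν := by rw [← mul_pow]; norm_num
            nlinarith
        _ = 4 ^ t := by rw [pow_mul]; norm_num
    have h3 : 2 * t * (2 ^ 34 * (t + 1) ^ 4 * (t + 1)) ≤ 2 * t * (2 * t).choose t := by
      refine le_trans ?_ (h2.trans h1)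
      calc _ = 2 ^ 35 * (t * (t + 1) ^ 5) := by ring
        _ ≤ 2 ^ 35 * ((t + 1) * (t + 1) ^ 5) := by gcongr; omega
        _ = _ := by ring
    exact Nat.le_of_mul_le_mul_left h3 (by omega)
  have hmin : ∀ i, 1 ≤ i → min (i * t) e = e := fun i hi => by
    have : t ≤ i * t := Nat.le_mul_of_pos_left _ hi
    omega
  have hodd : ∀ i < 1, A ≤ t.choose (min (i * t) e) * (t + s).choose (t - min (i * t) e) := by
    intro i hi
    obtain rfl : i = 0 := by omega
    simpa using hA2
  refine isClassZero_of_spheres (q := t) (h := 1) (e := e) (ρ := 1) (k₀ := A) (A := A) ht hts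
    (by omega) he hN le_rfl (by omega) ?_ ?_ ?_ hodd ?_ fun i hi _ => hodd i hi
  · refine le_trans ?_ hA
    have : 1 ≤ (t + 1) ^ 4 := Nat.one_le_pow _ _ (by omega)
    omega
  · refine le_trans (le_of_eq ?_) hA
    norm_num
  · intro i hi; rw [hmin i hi]; exact hA1
  · intro i hi; rw [hmin i (by omega)]; exact hA1

/-- The case of small `s`: walks exchange `q ≤ s` elements in every two steps. -/
lemma isClassZero_of_lt {ν κ q : ℕ} (hκ : 1 ≤ κ) (htν : 4 ^ ν ≤ t) (htν' : t < 4 ^ (ν + 1))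
    (hst : s < t) (hqs : q ≤ s) (hqν : q ≤ 2 ^ ν) (hq16 : 16 ≤ q)
    (hmain : 13 * t ≤ ν / 2 * κ * q ^ 2) (hν₁ : 6 + 3 * κ ≤ ν) (hν₂ : 34 + 16 * κ + 8 * ν ≤ 2 ^ ν)
    (hν₃ : κ * 2 ^ (ν / 2 + 1) ≤ 2 ^ ν) :
    Pebbling.IsClassZero (kneserGraph (2 * t + s) t) := by
  have h4 : (4 : ℕ) ^ ν = 2 ^ ν * 2 ^ ν := by rw [← mul_pow]; norm_num
  have ht : 1 ≤ t := by omega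
  obtain ⟨e, he, hmax, hN⟩ := exists_mode t s
  obtain ⟨he1, he2⟩ := mode_bounds he hst.le hmax
  set μ := ν / 2 with hμ
  set b := κ * q with hb
  set d := t / q with hd
  have hqb : q ≤ b := Nat.le_mul_of_pos_left _ hκ
  have hb1 : b ≤ κ * 2 ^ ν := Nat.mul_le_mul_left _ hqν
  have hbt : 3 * b + 2 ≤ t := by nlinarith
  have hμb : 2 ^ μ * b + b ≤ t + 1 := by
    have h1 : 1 ≤ 2 ^ μ := Nat.one_le_two_pow
    calc 2 ^ μ * b + b ≤ 2 ^ μ * b + 2 ^ μ * b := by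
          have := Nat.le_mul_of_pos_left b h1
          omega
      _ ≤ 2 ^ μ * (κ * 2 ^ ν) + 2 ^ μ * (κ * 2 ^ ν) := by gcongr
      _ = κ * 2 ^ (μ + 1) * 2 ^ ν := by ring
      _ ≤ 2 ^ ν * 2 ^ ν := Nat.mul_le_mul_right _ hν₃
      _ ≤ t + 1 := by omega
  have hCb : 2 ^ (μ * b) ≤ t.choose b := pow_le_choose (by omega) hμb
  have hCq : 2 ^ (μ * q) ≤ t.choose q := pow_le_choose (by omega) (by
    have : 2 ^ μ * q ≤ 2 ^ μ * b := Nat.mul_le_mul_left _ hqb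
    omega)
  have hdq : d * q ≤ t := Nat.div_mul_le_self t q
  have htd : t < (d + 1) * q := by
    rw [mul_comm]; exact Nat.lt_mul_div_succ t (by omega)
  have hd1 : 2 ^ ν ≤ d := by
    rw [hd, Nat.le_div_iff_mul_le (by omega)]
    calc 2 ^ ν * q ≤ 2 ^ ν * 2 ^ ν := Nat.mul_le_mul_left _ hqν
      _ ≤ t := by omega
  -- The decisive inequality. Since `ℓ = 2 * (d + 1)`, the factor `(2 ^ ℓ) ^ 6` uses up `12 * d` in
  -- the exponent; the remaining `d ≥ 2 ^ ν` absorbs the lower-order terms.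
  have hd2 : 13 * d ≤ μ * b := by
    have h1 : 13 * d * q ≤ μ * b * q := by
      calc 13 * d * q = 13 * (d * q) := by ring
        _ ≤ 13 * t := by omega
        _ ≤ μ * κ * q ^ 2 := hmain
        _ = μ * b * q := by rw [hb]; ring
    exact Nat.le_of_mul_le_mul_right h1 (by omega)
  have ht1 : t + 1 ≤ 2 ^ (2 * ν + 2) := by
    rw [show 2 * ν + 2 = 2 * (ν + 1) by ring, pow_mul]; exact htν'
  have hdt : d ≤ t := Nat.div_le_self _ _
  have hlow : ∀ i, 1 ≤ i → q ≤ min (i * q) e := fun i hi => by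
    have : q ≤ i * q := Nat.le_mul_of_pos_left _ hi
    omega
  have hlow' : ∀ i, κ ≤ i → b ≤ min (i * q) e := fun i hi => by
    have : b ≤ i * q := Nat.mul_le_mul_right _ hi
    omega
  -- As the mode is at most about `2 * t / 3`, the walk never leaves the range in which `t.choose`
  -- is at least `t.choose b`.
  have hup : ∀ i, min (i * q) e + b ≤ t := fun i => by omega
  have hlarge : ∀ i, 1 ≤ i → t.choose q ≤ t.choose (min (i * q) e) := fun i hi =>
    choose_le_choose_of_add_le (hlow i hi) (by have := hup i; omega)
  have hlarge' : ∀ i, κ ≤ i → t.choose b ≤ t.choose (min (i * q) e) := fun i hi =>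
    choose_le_choose_of_add_le (hlow' i hi) (hup i)
  have hfst : ∀ i, 0 < (t + s).choose (min (i * q) e) := fun i => Nat.choose_pos (by omega)
  have hsnd : ∀ i, 0 < (t + s).choose (t - min (i * q) e) := fun i => Nat.choose_pos (by omega)
  refine isClassZero_of_spheres (q := q) (h := d + 1) (e := e) (ρ := 2 * κ) (k₀ := t.choose q)
    (A := t.choose b) ht hqs htd.le he hN (by omega) (by omega) ?_ ?_ ?_ ?_ ?_ ?_
  · refine le_trans ?_ hCq
    have h1 : 2 * (d + 1) + 1 ≤ 2 ^ (2 * ν + 4) := by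
      calc 2 * (d + 1) + 1 ≤ 4 * (t + 1) := by omega
        _ ≤ 4 * 2 ^ (2 * ν + 2) := by omega
        _ = _ := by ring
    calc 2 ^ 8 * (2 ^ (2 * κ)) ^ 6 * (2 * (d + 1) + 1) ^ 2
        ≤ 2 ^ 8 * (2 ^ (2 * κ)) ^ 6 * (2 ^ (2 * ν + 4)) ^ 2 := by gcongr
      _ = 2 ^ (16 + 12 * κ + 4 * ν) := by rw [← pow_mul, ← pow_mul, ← pow_add, ← pow_add]; ring_nf
      _ ≤ 2 ^ (μ * q) := by
          apply Nat.pow_le_pow_right (by norm_num)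
          have h2 : μ * 16 ≤ μ * q := Nat.mul_le_mul_left _ hq16
          omega
  · refine le_trans ?_ hCb
    calc 2 ^ 14 * (2 ^ (2 * κ)) ^ 8 * (2 ^ (2 * (d + 1))) ^ 6 * (t + 1) ^ 4
        ≤ 2 ^ 14 * (2 ^ (2 * κ)) ^ 8 * (2 ^ (2 * (d + 1))) ^ 6 * (2 ^ (2 * ν + 2)) ^ 4 := by gcongr
      _ = 2 ^ (34 + 16 * κ + 8 * ν + 12 * d) := by
          rw [← pow_mul, ← pow_mul, ← pow_mul, ← pow_add, ← pow_add, ← pow_add]; ring_nf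
      _ ≤ 2 ^ (μ * b) := by
          apply Nat.pow_le_pow_right (by norm_num)
          omega
  · exact fun i hi => (hlarge i hi).trans (Nat.le_mul_of_pos_right _ (hfst i))
  · intro i _
    rcases Nat.eq_zero_or_pos i with rfl | hi
    · simp only [zero_mul, Nat.zero_min, Nat.choose_zero_right, one_mul, Nat.sub_zero]
      -- The first step leads to a set disjoint from the start, of which there are `(t + s).choose
      -- s`.
      rw [Nat.choose_symm_add]
      exact (Nat.choose_le_choose _ (by omega)).trans
        (choose_le_choose_of_add_le hqs (by omega))
    · exact (hlarge i hi).trans (Nat.le_mul_of_pos_right _ (hsnd i))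
  · exact fun i hi => (hlarge' i (by omega)).trans (Nat.le_mul_of_pos_right _ (hfst i))
  · exact fun i _ hi => (hlarge' i (by omega)).trans (Nat.le_mul_of_pos_right _ (hsnd i))

/-- For a given `κ`, the Kneser graph is Class 0 if `t` is large and `s` is not too small. -/
lemma isClassZero_of_large {ν κ : ℕ} (hκ : 1 ≤ κ) (hν : 300 + 300 * κ ≤ ν) (htν : 4 ^ ν ≤ t)
    (htν' : t < 4 ^ (ν + 1)) (hs : 13 * t ≤ ν / 2 * κ * s ^ 2) :
    Pebbling.IsClassZero (kneserGraph (2 * t + s) t) := by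
  by_cases hts : t ≤ s
  · exact isClassZero_of_le (by omega) htν htν' hts
  have h4 : (4 : ℕ) ^ ν = 2 ^ ν * 2 ^ ν := by rw [← mul_pow]; norm_num
  have hsq : ν ^ 2 ≤ 2 ^ ν := by
    have : ∀ n, 4 ≤ n → n ^ 2 ≤ 2 ^ n := by
      intro n hn
      induction n, hn using Nat.le_induction with
      | base => norm_num
      | succ n hn ih => rw [pow_succ 2 n]; nlinarith
    exact this ν (by omega)
  have hν₂ : 34 + 16 * κ + 8 * ν ≤ 2 ^ ν := by nlinarith
  have hν₃ : κ * 2 ^ (ν / 2 + 1) ≤ 2 ^ ν := by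
    have h1 : κ ≤ 2 ^ κ := Nat.lt_two_pow_self.le
    calc κ * 2 ^ (ν / 2 + 1) ≤ 2 ^ κ * 2 ^ (ν / 2 + 1) := Nat.mul_le_mul_right _ h1
      _ = 2 ^ (κ + (ν / 2 + 1)) := by rw [← pow_add]
      _ ≤ 2 ^ ν := Nat.pow_le_pow_right (by norm_num) (by omega)
  have hs16 : 16 ≤ s := by
    by_contra hcon
    have h1 : s ^ 2 ≤ 16 ^ 2 := Nat.pow_le_pow_left (by omega) 2
    have h2 : ν / 2 * κ * s ^ 2 ≤ ν * ν * 256 := by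
      calc ν / 2 * κ * s ^ 2 ≤ ν * ν * 16 ^ 2 := by gcongr <;> omega
        _ = _ := by norm_num
    have h3 : 300 ≤ 2 ^ ν := by omega
    nlinarith
  -- Capping `q` at `2 ^ ν`, about `√t`, keeps `t / (κ * q)` large enough for the lower bound on
  -- `t.choose (κ * q)`.
  refine isClassZero_of_lt (ν := ν) (κ := κ) (q := min s (2 ^ ν)) hκ htν htν' (by omega)
    (min_le_left _ _) (min_le_right _ _) (by omega) ?_ (by omega) hν₂ hν₃
  rcases le_total s (2 ^ ν) with h | h
  · rwa [min_eq_left h]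
  · rw [min_eq_right h]
    have h1 : 52 ≤ ν / 2 * κ := le_trans (by omega) (Nat.le_mul_of_pos_right (ν / 2) hκ)
    calc 13 * t ≤ 52 * (2 ^ ν) ^ 2 := by
          rw [sq, ← h4]; rw [pow_succ] at htν'; omega
      _ ≤ _ := Nat.mul_le_mul_right _ h1

end Kneser

theorem mainTheorem4 (c : ℝ) (hc : 0 < c) :
    ∃ t₀ : ℕ, ∀ t s n : ℕ, t₀ < t → c * Real.sqrt ((t : ℝ) / Real.logb 2 (t : ℝ)) ≤ (s : ℝ) →
      n = 2 * t + s → Pebbling.IsClassZero (kneserGraph n t) := by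
  -- `104 = 13 * 8`: the factor `13` is required by `isClassZero_of_large`, and `8` is lost in
  -- comparing `logb 2 t` with `ν / 2`.
  obtain ⟨κ, hκ⟩ := exists_nat_ge (104 / c ^ 2)
  have hκ' : 104 ≤ κ * c ^ 2 := by
    rwa [div_le_iff₀ (by positivity)] at hκ
  have hκ1 : 1 ≤ κ := by
    by_contra h
    obtain rfl : κ = 0 := by omega
    norm_num at hκ'
  refine ⟨4 ^ (300 + 300 * κ), ?_⟩
  rintro t s n ht hs rfl
  set ν := Nat.log 4 t with hνdef
  have ht0 : t ≠ 0 := (Nat.zero_lt_of_lt ht).ne'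
  have hν : 300 + 300 * κ ≤ ν := Nat.le_log_of_pow_le (by norm_num) ht.le
  have htν' : t < 4 ^ (ν + 1) := Nat.lt_pow_succ_log_self (by norm_num) t
  refine Kneser.isClassZero_of_large hκ1 hν (Nat.pow_log_le_self 4 ht0) htν' ?_
  have ht1 : 1 < t := lt_of_le_of_lt (Nat.one_le_pow _ _ (by norm_num)) ht
  have ht1' : (1 : ℝ) < t := by exact_mod_cast ht1
  have hlogpos : 0 < Real.logb 2 t := Real.logb_pos (by norm_num) ht1'
  have hlog : Real.logb 2 t ≤ 8 * (ν / 2 : ℕ) := by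
    have h1 : Real.logb 2 t ≤ Real.logb 2 ((2 : ℝ) ^ (2 * ν + 2)) := by
      apply Real.logb_le_logb_of_le (by norm_num) (by linarith)
      rw [show 2 * ν + 2 = 2 * (ν + 1) by ring, pow_mul]
      norm_num
      exact_mod_cast htν'.le
    rw [Real.logb_pow, Real.logb_self_eq_one (by norm_num), mul_one] at h1
    refine h1.trans ?_
    exact_mod_cast (show 2 * ν + 2 ≤ 8 * (ν / 2) by omega)
  have hsq : c ^ 2 * t ≤ s ^ 2 * Real.logb 2 t := by
    have h1 : (c * Real.sqrt ((t : ℝ) / Real.logb 2 t)) ^ 2 ≤ (s : ℝ) ^ 2 :=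
      pow_le_pow_left₀ (by positivity) hs 2
    rw [mul_pow, Real.sq_sqrt (by positivity), ← mul_div_assoc, div_le_iff₀ hlogpos] at h1
    exact h1
  have hfin : (13 * t : ℝ) ≤ (ν / 2 : ℕ) * κ * (s : ℝ) ^ 2 := by
    have h1 : (s : ℝ) ^ 2 * Real.logb 2 t ≤ s ^ 2 * (8 * (ν / 2 : ℕ)) := by gcongr
    have h2 : (κ : ℝ) * (c ^ 2 * t) ≤ κ * (s ^ 2 * (8 * (ν / 2 : ℕ))) :=
      mul_le_mul_of_nonneg_left (hsq.trans h1) (by positivity)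
    have h3 : 104 * (t : ℝ) ≤ κ * c ^ 2 * t := by gcongr
    nlinarith
  exact_mod_cast hfin
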